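/- **Theorem (McKay's observation).** Let $\Delta$ be one of the Dynkin diagrams $A_{2m-1}$ ($m\ge 1$), $D_n$ ($n\ge 4$), $E_6$, $E_7$, $E_8$, with vertices $1,\dots,r$ and Coxeter number $h$, and let $\tilde\Delta$ be its extended Dynkin diagram, with additional (affine) vertex $0$ and adjacency matrix $\tilde{\mathcal A}=(\tilde a_{ij})_{0\le i,j\le r}$, where $\tilde a_{ij}$ is the number of edges joining $i$ and $j$ (so $\tilde a_{ij}\in\{0,1\}$, except that $\tilde a_{01}=\tilde a_{10}=2$ for $A_1$). (1) Let $G\subset SU(2)$ be a finite subgroup that corresponds to $\Delta$ under the McKay correspondence; that is, its irreducible complex representations, up to isomorphism, are labelled $\rho_0,\dots,\rho_r$ by the vertices of $\tilde\Delta$, with $\rho_0$ trivial, in such a way that $\tilde a_{jk}$ is the multiplicity of $\rho_k$ in $\mathbb C^2\otimes\rho_j$ for all $j,k$. Let $\pi_n$ be the representation of $SU(2)$ on $\mathrm{Sym}^n(\mathbb C^2)$, let $m_i(n)$ be the multiplicity of $\rho_i$ in $\pi_n|_G$, and let $[P_G(t)]_i=\sum_{n\ge 0}m_i(n)t^n$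 be the components of the Kostant generating function. Then, as formal Laurent series, $$(t+t^{-1})\,[P_G(t)]_i=\sum_{j\text{ adjacent to }i}[P_G(t)]_j\qquad\text{for } i=1,\dots,r,$$ where $j$ runs over the vertices of $\tilde\Delta$ adjacent to $i$, counted with the number of edges, i.e. the right-hand side is $\sum_{j=0}^r\tilde a_{ij}[P_G(t)]_j$. The component $[P_G(t)]_0$ thus occurs on the right-hand side only. (2) Let $\beta$ be the highest root of the root system of $\Delta$. Colour the vertices of $\Delta$ with two colours so that adjacent vertices have different colours, let $w_1$ and $w_2$ be the products of the (commuting) simple reflections over the two colour classes, numbered so that $w_2\beta=\beta$, and let $\tau^{(n)}=\cdots w_1w_2w_1$ ($n$ factors, the rightmost being $w_1$). Let $\alpha_0,\dots,\alpha_r$ be the simple roots of $\tilde\Delta$, put $z_0=z_h=\alpha_0$ and $z_n=\tau^{(n-1)}\beta-\tau^{(n)}\beta$ for $1\le n\le h-1$ (with zero $\alpha_0$-coordinate), and let $z(t)_i=\sum_{n=0}^{h}(z_n)_it^n$ be the assembling polynomials, $(z_n)_i$ being the coefficient of $\alpha_i$ in $z_n$. Let $\mathcal A^\gamma$ be the semi-affine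 adjacency matrix, obtained from $\tilde{\mathcal A}$ by replacing the row of the affine vertex by zero. Then $$(t+t^{-1})\,z(t)_i=(\mathcal A^\gamma z(t))_i\qquad\text{for } i=1,\dots,r.$$ -/

import Mathlib

open scoped LaurentPolynomial

universe u

namespace McKay

/-! ### Dynkin diagrams and their extended diagrams -/

/-- The simply-laced Dynkin diagrams with even Coxeter number:
`A m` is the diagram `A_{2m-1}` (`m ≥ 1`), `D n` is the diagram `D_n` (`n ≥ 4`). -/
inductive Diagram : Type
  | A (m : ℕ) (hm : 1 ≤ m) : Diagram
  | D (n : ℕ) (hn : 4 ≤ n) : Diagram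
  | E6 : Diagram
  | E7 : Diagram
  | E8 : Diagram

namespace Diagram

/-- The number `r` of vertices of the (non-extended) Dynkin diagram. -/
def rank : Diagram → ℕ
  | A m _ => 2 * m - 1
  | D n _ => n
  | E6 => 6
  | E7 => 7
  | E8 => 8

/-- The Coxeter number `h`. -/
def coxeterNumber : Diagram → ℕ
  | A m _ => 2 * m
  | D n _ => 2 * n - 2
  | E6 => 12
  | E7 => 18
  | E8 => 30

/-- The edges of the extended Dynkin diagram on the vertices `0, 1, …, r`, each listed in one
direction. The vertex `0` is the affine one, the others are in Bourbaki's numbering: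
* `A_{2m-1}`: the cycle `0 — 1 — ⋯ — 2m-1 — 0` (a double edge `0 = 1` if `m = 1`);
* `D_n`: the chain `1 — 2 — ⋯ — n-1` and the edges `n-2 — n`, `0 — 2`;
* `E_n`: the chain `1 — 3 — 4 — ⋯ — n`, the edge `2 — 4`, and the edge
  `0 — 2`, `0 — 1`, `0 — 8` for `n = 6, 7, 8` respectively. -/
def edge : Diagram → ℕ → ℕ → ℕ
  | A m _, i, j => if j = (i + 1) % (2 * m) then 1 else 0
  | D n _, i, j =>
      if (1 ≤ i ∧ j = i + 1 ∧ j ≤ n - 1) ∨ (i = n - 2 ∧ j = n) ∨ (i = 0 ∧ j = 2) then 1 else 0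
  | E6, i, j =>
      if (i, j) ∈ [(1, 3), (3, 4), (4, 5), (5, 6), (2, 4), (0, 2)] then 1 else 0
  | E7, i, j =>
      if (i, j) ∈ [(1, 3), (3, 4), (4, 5), (5, 6), (6, 7), (2, 4), (0, 1)] then 1 else 0
  | E8, i, j =>
      if (i, j) ∈ [(1, 3), (3, 4), (4, 5), (5, 6), (6, 7), (7, 8), (2, 4), (0, 8)] then 1 else 0

/-- The adjacency matrix of the extended Dynkin diagram: the `(i, j)` entry is the number of edges
joining `i` and `j`. It is `0` or `1`, except that the two vertices of the extended diagram of
`A_1` are joined by two edges. -/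
def extAdj (Δ : Diagram) : Matrix (Fin (Δ.rank + 1)) (Fin (Δ.rank + 1)) ℕ :=
  fun i j => Δ.edge i j + Δ.edge j i

/-- The adjacency matrix `𝒜` of the Dynkin diagram, obtained by removing the affine vertex.
The vertex `i : Fin r` of the Dynkin diagram is the vertex `i.succ` of the extended one. -/
def adj (Δ : Diagram) : Matrix (Fin Δ.rank) (Fin Δ.rank) ℤ :=
  fun i j => (Δ.extAdj i.succ j.succ : ℤ)

/-- The semi-affine adjacency matrix `𝒜^γ`: the row of the affine vertex in the adjacency matrix of
the extended Dynkin diagram is replaced by zero. -/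
def semiAffineAdj (Δ : Diagram) : Matrix (Fin (Δ.rank + 1)) (Fin (Δ.rank + 1)) ℕ :=
  fun i j => if i = 0 then 0 else Δ.extAdj i j

/-! ### The root system, in coordinates with respect to the simple roots -/

/-- The transformation `x_i ↦ -x_i + ∑_j 𝒜_{ij} x_j` for `i ∈ S`, `x_i ↦ x_i` for `i ∉ S`.
For `S = {k}` this is the simple reflection `s_k`; for a set `S` of pairwise non-adjacent vertices
it is the product of the commuting reflections `s_k`, `k ∈ S`. -/
def reflect (Δ : Diagram) (S : Finset (Fin Δ.rank)) (x : Fin Δ.rank → ℤ) : Fin Δ.rank → ℤ :=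
  fun i => if i ∈ S then (∑ j, Δ.adj i j * x j) - x i else x i

/-- The roots: the images of the simple roots under the Weyl group. -/
inductive IsRoot (Δ : Diagram) : (Fin Δ.rank → ℤ) → Prop
  | simple (i : Fin Δ.rank) : IsRoot Δ (Pi.single i 1)
  | reflect (k : Fin Δ.rank) (x : Fin Δ.rank → ℤ) (hx : IsRoot Δ x) :
      IsRoot Δ (Δ.reflect {k} x)

/-- `β` is the highest root: a root such that `β - α` has nonnegative coordinates for every
root `α`. -/
def IsHighestRoot (Δ : Diagram) (β : Fin Δ.rank → ℤ) : Prop :=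
  Δ.IsRoot β ∧ ∀ α, Δ.IsRoot α → α ≤ β

/-- Every edge of the Dynkin diagram joins a vertex of `Y` with a vertex of its complement. -/
def IsBipartition (Δ : Diagram) (Y : Finset (Fin Δ.rank)) : Prop :=
  ∀ i j, Δ.adj i j ≠ 0 → (i ∈ Y ↔ j ∉ Y)

/-- The alternating product `τ^{(n)} = ⋯ w₁ w₂ w₁` of `n` factors, where `w₁` is the product of
the simple reflections of the vertices in `Y` and `w₂` that of the remaining vertices. -/
def tau (Δ : Diagram) (Y : Finset (Fin Δ.rank)) : ℕ → (Fin Δ.rank → ℤ) → (Fin Δ.rank → ℤ)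
  | 0, x => x
  | n + 1, x => if Even n then Δ.reflect Y (Δ.tau Y n x) else Δ.reflect Yᶜ (Δ.tau Y n x)

/-- The assembling vectors `z_n`, `0 ≤ n ≤ h`: `z_0 = z_h = α_0` is the affine simple root, and
`z_n = τ^{(n-1)} β - τ^{(n)} β` (with affine coordinate zero) for `1 ≤ n ≤ h - 1`. -/
def assemblingVector (Δ : Diagram) (Y : Finset (Fin Δ.rank)) (β : Fin Δ.rank → ℤ) (n : ℕ) :
    Fin (Δ.rank + 1) → ℤ :=
  if n = 0 ∨ n = Δ.coxeterNumber then Pi.single 0 1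
  else Fin.cons 0 (Δ.tau Y (n - 1) β - Δ.tau Y n β)

/-- The assembling polynomials `z(t)_i = ∑_{n=0}^{h} (z_n)_i t^n`. -/
noncomputable def assemblingPolynomial (Δ : Diagram) (Y : Finset (Fin Δ.rank))
    (β : Fin Δ.rank → ℤ) (i : Fin (Δ.rank + 1)) : ℤ[T;T⁻¹] :=
  ∑ n ∈ Finset.range (Δ.coxeterNumber + 1),
    LaurentPolynomial.C (Δ.assemblingVector Y β n i) * LaurentPolynomial.T (n : ℤ)

end Diagram

/-! ### Representations of `SU(2)` and of its finite subgroups -/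

/-- The group `SU(2)`. -/
abbrev SU2 : Type := Matrix.specialUnitaryGroup (Fin 2) ℂ

/-- The standard representation of `SU(2)` on `ℂ²`. -/
noncomputable def stdRep : Representation ℂ SU2 (Fin 2 → ℂ) where
  toFun g := Matrix.toLin' (g : Matrix (Fin 2) (Fin 2) ℂ)
  map_one' := by simp; rfl
  map_mul' g h := by simp [Matrix.toLin'_mul]; rfl

/-- The action of `g` on the generator `x_j` (the `j`-th basis vector of `ℂ²`) of the symmetric
algebra `Sym(ℂ²) = ℂ[x_0, x_1]`. -/
noncomputable def actX (g : SU2) (j : Fin 2) : MvPolynomial (Fin 2) ℂ :=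
  ∑ i, MvPolynomial.C ((g : Matrix (Fin 2) (Fin 2) ℂ) i j) * MvPolynomial.X i

/-- The representation of `SU(2)` on the symmetric algebra `Sym(ℂ²) = ℂ[x_0, x_1]`, by algebra
automorphisms extending the action on `ℂ²`. -/
noncomputable def symAlgRep : Representation ℂ SU2 (MvPolynomial (Fin 2) ℂ) where
  toFun g := (MvPolynomial.aeval (actX g)).toLinearMap
  map_one' := by
    have h : MvPolynomial.aeval (actX 1) = AlgHom.id ℂ (MvPolynomial (Fin 2) ℂ) := by
      ext1 j
      fin_cases j <;> simp [actX]
    rw [h]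
    rfl
  map_mul' g h := by
    have H : MvPolynomial.aeval (actX (g * h)) =
        (MvPolynomial.aeval (actX g)).comp (MvPolynomial.aeval (R := ℂ) (actX h)) := by
      ext1 j
      simp [actX, Matrix.mul_apply, Fin.sum_univ_two]
      ring
    rw [H]
    rfl

theorem actX_isHomogeneous (g : SU2) (j : Fin 2) : (actX g j).IsHomogeneous 1 :=
  MvPolynomial.IsHomogeneous.sum _ _ _ fun _ _ => MvPolynomial.isHomogeneous_C_mul_X _ _

/-- The representation `π_n` of `SU(2)` on `Sym^n(ℂ²)`, the homogeneous polynomials of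
degree `n`. -/
noncomputable def symPowRep (n : ℕ) :
    Representation ℂ SU2 (MvPolynomial.homogeneousSubmodule (Fin 2) ℂ n) :=
  symAlgRep.subrepresentation _ fun g p hp => by
    have h := MvPolynomial.IsHomogeneous.aeval hp (actX g) (actX_isHomogeneous g)
    rw [one_mul] at h
    exact h

/-- The restriction of a representation of `SU(2)` to a subgroup. -/
noncomputable def restrict {W : Type u} [AddCommGroup W] [Module ℂ W]
    (σ : Representation ℂ SU2 W) (G : Subgroup SU2) : Representation ℂ G W :=
  σ.comp G.subtype

/-- The multiplicity of an irreducible complex representation `ρ` in `σ`: the dimension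
of `Hom_G(ρ, σ)`. -/
noncomputable def multiplicity {G : Type*} [Group G] {V W : Type*} [AddCommGroup V] [Module ℂ V]
    [AddCommGroup W] [Module ℂ W] (ρ : Representation ℂ G V) (σ : Representation ℂ G W) : ℕ :=
  Module.finrank ℂ (ρ.IntertwiningMap σ)

/-- `ρ_0, …, ρ_r` are all the irreducible complex representations of `G`, each isomorphism class
occurring once, and `ρ_0` is the trivial one. -/
structure IsIrrepList {G : Type*} [Group G] {r : ℕ} {V : Fin (r + 1) → Type u}
    [∀ i, AddCommGroup (V i)] [∀ i, Module ℂ (V i)] (ρ : ∀ i, Representation ℂ G (V i)) :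
    Prop where
  irreducible : ∀ i, (ρ i).IsIrreducible
  distinct : ∀ i j, Nonempty ((ρ i).Equiv (ρ j)) → i = j
  complete : ∀ (W : Type u) [AddCommGroup W] [Module ℂ W] (σ : Representation ℂ G W),
    σ.IsIrreducible → ∃ i, Nonempty (σ.Equiv (ρ i))
  trivial : (ρ 0).IsTrivial

/-- The McKay matrix `A(G)`: the `(j, k)` entry is the multiplicity of `ρ_k` in `ℂ² ⊗ ρ_j`. -/
noncomputable def mckayMatrix (G : Subgroup SU2) {r : ℕ} {V : Fin (r + 1) → Type u}
    [∀ i, AddCommGroup (V i)] [∀ i, Module ℂ (V i)] (ρ : ∀ i, Representation ℂ G (V i)) :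
    Matrix (Fin (r + 1)) (Fin (r + 1)) ℕ :=
  fun j k => multiplicity (ρ k) ((restrict stdRep G).tprod (ρ j))

/-- The component `[P_G(t)]_i = ∑_n m_i(n) t^n` of the Kostant generating function, where `m_i(n)`
is the multiplicity of `ρ_i` in `π_n | G`, as a formal Laurent series. -/
noncomputable def kostantSeries (G : Subgroup SU2) {r : ℕ} {V : Fin (r + 1) → Type u}
    [∀ i, AddCommGroup (V i)] [∀ i, Module ℂ (V i)] (ρ : ∀ i, Representation ℂ G (V i))
    (i : Fin (r + 1)) : LaurentSeries ℤ :=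
  HahnSeries.ofPowerSeries ℤ ℤ
    (PowerSeries.mk fun n => (multiplicity (ρ i) (restrict (symPowRep n) G) : ℤ))

end McKay

namespace McKay

/-! ### Characters of a finite group -/

section Characters

open Representation

variable {G : Type*} [Group G] {V W W₁ W₂ : Type*} [AddCommGroup V] [Module ℂ V]
  [AddCommGroup W] [Module ℂ W] [AddCommGroup W₁] [Module ℂ W₁] [AddCommGroup W₂] [Module ℂ W₂]

/-! Both identities come from a recurrence of the form `u (n+2) + u n = A u (n+1)`. Multiplication
by `t + t⁻¹` turns it into the adjacency equation, so what remains is its behaviour at the ends of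
the series.

Part (1). Clebsch-Gordan, `ℂ² ⊗ Sym^(n+1) = Sym^n ⊕ Sym^(n+2)`, is realised by an exact sequence of
Koszul type (`symWedge`, `symMul`). Characters of `G` are additive on such a sequence by Maschke,
and pairing with `ρ i` gives the recurrence for multiplicities (`sum_mckayMatrix_mul_symPow_succ`).
The only possible extra term is the coefficient of `t⁻¹`. It is the multiplicity of `ρ i` in the
trivial representation `Sym^0`, which is zero for `i ≠ 0`.

Part (2). The differences `d n = τ^(n) β - τ^(n+1) β` are supported on alternating colour classes,
and this makes them satisfy the same recurrence (`tauDiff_add_two`); `w₂ β = β` extends it backwards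
by zero. The initial value `d 0` consists of the pairings of `β` with the simple roots, which are
the numbers of edges to the affine vertex (`IsHighestRoot.cartan_eq`). This follows by comparing `β`
with the vector `θ` of marks, using positivity of the form. The sequence is thus determined, and an
explicit solution for each diagram (`exists_recurrence_solution`) shows that it vanishes at `h` and
returns at `h - 1` to its initial value. The two affine terms `z_0 = z_h = α_0` then supply
precisely the missing boundary coefficients. -/

theorem character_eq_add_of_isCompl [FiniteDimensional ℂ W] (σ : Representation ℂ G W)
    (N N' : Subrepresentation σ) (h : IsCompl N N') :
    σ.character = N.toRepresentation.character + N'.toRepresentation.character := by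
  have h' : IsCompl N.toSubmodule N'.toSubmodule := by
    constructor
    · rw [disjoint_iff]
      exact congrArg Subrepresentation.toSubmodule h.inf_eq_bot
    · rw [codisjoint_iff]
      exact congrArg Subrepresentation.toSubmodule h.sup_eq_top
  ext g
  have key : σ g = (Submodule.prodEquivOfIsCompl _ _ h').conj
      (LinearMap.prodMap (N.toRepresentation g) (N'.toRepresentation g)) := by
    ext w
    obtain ⟨⟨x, y⟩, rfl⟩ := (Submodule.prodEquivOfIsCompl _ _ h').surjective w
    rw [LinearEquiv.conj_apply_apply, LinearEquiv.symm_apply_apply]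
    simp [Subrepresentation.toRepresentation]
  simp only [character, Pi.add_apply]
  rw [key, LinearMap.trace_conj', LinearMap.trace_prodMap']

variable [Finite G]

instance : NeZero (Nat.card G : ℂ) := ⟨by exact_mod_cast Nat.card_pos.ne'⟩

/-- By Maschke the image of `f` has an invariant complement `N`. Exactness makes `g` restrict to an
isomorphism from `N` onto `σ₂`. -/
theorem character_eq_add_of_exact [FiniteDimensional ℂ W] {σ₁ : Representation ℂ G W₁}
    {σ : Representation ℂ G W} {σ₂ : Representation ℂ G W₂}
    (f : σ₁.IntertwiningMap σ) (g : σ.IntertwiningMap σ₂) (hf : Function.Injective f)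
    (hg : Function.Surjective g) (hfg : Function.Exact f g) :
    σ.character = σ₁.character + σ₂.character := by
  obtain ⟨N, hN⟩ := exists_isCompl f.range
  have hmem : ∀ w, w ∈ f.range ↔ g w = 0 := fun w => by
    rw [IntertwiningMap.mem_range, hfg w]; rfl
  have e₁ : σ₁.Equiv f.range.toRepresentation := by
    refine Representation.IntertwiningMap.ofBijective
      ⟨f.toLinearMap.rangeRestrict, fun x => ?_⟩ ⟨?_, ?_⟩
    · ext v
      exact IntertwiningMap.isIntertwining _ _ f x v
    · intro v w hvw
      exact hf (congrArg Subtype.val hvw)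
    · exact f.toLinearMap.surjective_rangeRestrict
  have e₂ : N.toRepresentation.Equiv σ₂ := by
    refine Representation.IntertwiningMap.ofBijective
      ⟨g.toLinearMap.domRestrict N.toSubmodule, fun x => ?_⟩ ⟨?_, ?_⟩
    · ext v
      exact IntertwiningMap.isIntertwining _ _ g x v
    · refine (injective_iff_map_eq_zero (g.toLinearMap.domRestrict N.toSubmodule)).2
        fun v hv => ?_
      have : (v : W) ∈ f.range ⊓ N := ⟨(hmem v).2 hv, v.2⟩
      rw [hN.inf_eq_bot] at this
      exact Subtype.ext this
    · intro y
      obtain ⟨w, rfl⟩ := hg y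
      have hw : w ∈ (f.range ⊔ N).toSubmodule := by rw [hN.sup_eq_top]; trivial
      obtain ⟨a, ha, b, hb, rfl⟩ := Submodule.mem_sup.1 hw
      refine ⟨⟨b, hb⟩, ?_⟩
      rw [map_add, (hmem a).1 ha, zero_add]
      rfl
  rw [character_eq_add_of_isCompl σ _ _ hN, char_iso e₁, char_iso e₂]

/-- The orbit of a nonzero vector is finite and spans a nonzero invariant subspace. -/
theorem finiteDimensional_of_isIrreducible (ρ : Representation ℂ G V) (h : ρ.IsIrreducible) :
    FiniteDimensional ℂ V := by
  obtain ⟨v, hv⟩ : ∃ v : V, v ≠ 0 := by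
    by_contra! hcon
    refine bot_ne_top (α := Subrepresentation ρ) (Subrepresentation.toSubmodule_injective ?_)
    ext v
    simp [hcon v]
  let N : Subrepresentation ρ :=
    ⟨Submodule.span ℂ (Set.range fun g => ρ g v), fun g w hw => by
      induction hw using Submodule.span_induction with
      | mem x hx =>
        obtain ⟨k, rfl⟩ := hx
        exact Submodule.subset_span ⟨g * k, by simp⟩
      | zero => simp
      | add x y _ _ hx hy => rw [map_add]; exact add_mem hx hy
      | smul a x _ hx => rw [map_smul]; exact Submodule.smul_mem _ a hx⟩
  have hN : N = ⊤ := by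
    refine (h.eq_bot_or_eq_top N).resolve_left fun hb => hv ?_
    have hmem : v ∈ N.toSubmodule := Submodule.subset_span ⟨1, by simp⟩
    rw [hb] at hmem
    exact hmem
  have : Submodule.span ℂ (Set.range fun g => ρ g v) = ⊤ :=
    congrArg Subrepresentation.toSubmodule hN
  exact Module.finite_def.2 (this ▸ Submodule.fg_span (Set.finite_range _))

/-- The scalar product of two class functions. -/
noncomputable def charInner (χ ψ : G → ℂ) : ℂ := (Nat.card G : ℂ)⁻¹ * ∑ᶠ g, χ g * ψ g⁻¹

theorem multiplicity_eq_charInner [FiniteDimensional ℂ V] [FiniteDimensional ℂ W]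
    (ρ : Representation ℂ G V) (σ : Representation ℂ G W) :
    (multiplicity ρ σ : ℂ) = charInner σ.character ρ.character := by
  have := Fintype.ofFinite G
  have : Invertible (Nat.card G : ℂ) := invertibleOfNonzero (NeZero.ne _)
  rw [multiplicity, ← card_inv_mul_sum_char_mul_char_eq_finrank, charInner,
    finsum_eq_sum_of_fintype]

theorem charInner_add (χ₁ χ₂ ψ : G → ℂ) :
    charInner (χ₁ + χ₂) ψ = charInner χ₁ ψ + charInner χ₂ ψ := by
  have := Fintype.ofFinite G
  simp [charInner, finsum_eq_sum_of_fintype, add_mul, Finset.sum_add_distrib, mul_add]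

theorem charInner_sum_smul {ι : Type*} [Fintype ι] (c : ι → ℂ) (χ : ι → G → ℂ) (ψ : G → ℂ) :
    charInner (∑ i, c i • χ i) ψ = ∑ i, c i * charInner (χ i) ψ := by
  have := Fintype.ofFinite G
  simp only [charInner, finsum_eq_sum_of_fintype, Finset.sum_apply, Pi.smul_apply, smul_eq_mul,
    Finset.sum_mul, Finset.mul_sum]
  rw [Finset.sum_comm]
  exact Finset.sum_congr rfl fun _ _ => Finset.sum_congr rfl fun _ _ => by ring

end Characters

/-! ### Decomposition of characters along the list of irreducibles -/

section Irreps

open Representation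

variable {G : Type*} [Group G] [Finite G] {r : ℕ} {V : Fin (r + 1) → Type u}
  [∀ i, AddCommGroup (V i)] [∀ i, Module ℂ (V i)] {ρ : ∀ i, Representation ℂ G (V i)}

theorem IsIrrepList.multiplicity_eq (hρ : IsIrrepList ρ) (i j : Fin (r + 1)) :
    multiplicity (ρ i) (ρ j) = if i = j then 1 else 0 := by
  have := hρ.irreducible i
  have := hρ.irreducible j
  have := finiteDimensional_of_isIrreducible _ (hρ.irreducible i)
  split_ifs with h
  · subst h
    exact IsIrreducible.finrank_intertwiningMap_self (ρ i)
  · have : IsEmpty ((ρ i).Equiv (ρ j)) := ⟨fun e => h (hρ.distinct i j ⟨e⟩)⟩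
    exact Module.finrank_zero_of_subsingleton

/-- Complete reducibility by induction on a bound `d` for the dimension. The space lies in `Type u`
because completeness of the list is only assumed there. -/
theorem IsIrrepList.character_eq_sum_of_univ (hρ : IsIrrepList ρ) (d : ℕ) :
    ∀ (W : Type u) [AddCommGroup W] [Module ℂ W] [FiniteDimensional ℂ W]
      (σ : Representation ℂ G W), Module.finrank ℂ W ≤ d →
      σ.character = ∑ j, charInner σ.character (ρ j).character • (ρ j).character := by
  have hfin := fun i => finiteDimensional_of_isIrreducible _ (hρ.irreducible i)
  induction d with
  | zero =>
    intro W _ _ _ σ hd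
    have : Subsingleton W := Module.finrank_zero_iff.1 (Nat.le_zero.1 hd)
    have h0 : σ.character = 0 := by
      ext g
      simp [character, Subsingleton.elim (σ g) 0]
    simp [h0, charInner]
  | succ d ih =>
    intro W _ _ _ σ hd
    by_cases hσ : σ.IsIrreducible
    · obtain ⟨i, ⟨e⟩⟩ := hρ.complete W σ hσ
      rw [char_iso e]
      simp [← multiplicity_eq_charInner, hρ.multiplicity_eq]
    by_cases hW : Subsingleton W
    · exact ih W σ (by rw [Module.finrank_zero_of_subsingleton]; exact Nat.zero_le _)
    rw [not_subsingleton_iff_nontrivial] at hW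
    have : ∃ N : Subrepresentation σ, N ≠ ⊥ ∧ N ≠ ⊤ := by
      by_contra! hcon
      refine hσ { exists_pair_ne := ⟨⊥, ⊤, fun h => ?_⟩, eq_bot_or_eq_top := fun N => ?_ }
      · exact bot_ne_top (congrArg Subrepresentation.toSubmodule h)
      · exact or_iff_not_imp_left.2 (hcon N)
    obtain ⟨N, hb, ht⟩ := this
    obtain ⟨N', hN⟩ := exists_isCompl N
    have hlt : ∀ M : Subrepresentation σ, M ≠ ⊤ → Module.finrank ℂ M.toSubmodule ≤ d := by
      intro M hM
      have := Submodule.finrank_lt (s := M.toSubmodule)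
        (fun h => hM (Subrepresentation.toSubmodule_injective h))
      omega
    have ht' : N' ≠ ⊤ := fun h => hb (by simpa [h] using hN.inf_eq_bot)
    rw [character_eq_add_of_isCompl σ N N' hN]
    conv_lhs => rw [ih _ _ (hlt N ht), ih _ _ (hlt N' ht')]
    simp [charInner_add, add_smul, Finset.sum_add_distrib]

theorem IsIrrepList.character_eq_sum (hρ : IsIrrepList ρ) {W : Type} [AddCommGroup W] [Module ℂ W]
    [FiniteDimensional ℂ W] (σ : Representation ℂ G W) :
    σ.character = ∑ j, (multiplicity (ρ j) σ : ℂ) • (ρ j).character := by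
  have hfin := fun i => finiteDimensional_of_isIrreducible _ (hρ.irreducible i)
  -- The representation is transported to universe `u`, where completeness of the list applies.
  let e : ULift.{u} W ≃ₗ[ℂ] W := ULift.moduleEquiv
  let σ' : Representation ℂ G (ULift.{u} W) :=
    { toFun := fun g => e.symm.conj (σ g)
      map_one' := by ext; simp
      map_mul' := fun g h => by ext; simp }
  have hiso : σ'.Equiv σ := Representation.Equiv.mk e fun g => by ext; simp [σ']
  rw [← char_iso hiso]
  have := hρ.character_eq_sum_of_univ _ _ σ' le_rfl
  simp_rw [multiplicity_eq_charInner, ← char_iso hiso]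
  exact this

end Irreps

end McKay

namespace McKay

/-! ### The Clebsch-Gordan rule `ℂ² ⊗ Sym^(n+1) = Sym^(n+2) ⊕ Sym^n` -/

section ClebschGordan

open MvPolynomial TensorProduct Representation

local notation "S" => MvPolynomial.homogeneousSubmodule (Fin 2) ℂ

local notation "e" => fun i : Fin 2 => (Pi.single i (1 : ℂ) : Fin 2 → ℂ)

instance (n : ℕ) : FiniteDimensional ℂ (S n) :=
  Module.Finite.iff_fg.2 (homogeneousSubmodule_fg (Fin 2) ℂ n)

theorem symAlgRep_mul (g : SU2) (p q : MvPolynomial (Fin 2) ℂ) :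
    symAlgRep g (p * q) = symAlgRep g p * symAlgRep g q :=
  map_mul (aeval (actX g)) p q

theorem symAlgRep_X (g : SU2) (j : Fin 2) : symAlgRep g (X j) = actX g j :=
  aeval_X (actX g) j

theorem coe_symPowRep (n : ℕ) (g : SU2) (p : S n) :
    (symPowRep n g p : MvPolynomial (Fin 2) ℂ) = symAlgRep g p := rfl

theorem det_eq_one (g : SU2) :
    (g : Matrix (Fin 2) (Fin 2) ℂ) 0 0 * (g : Matrix (Fin 2) (Fin 2) ℂ) 1 1 -
      (g : Matrix (Fin 2) (Fin 2) ℂ) 0 1 * (g : Matrix (Fin 2) (Fin 2) ℂ) 1 0 = 1 := by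
  rw [← Matrix.det_fin_two]
  exact (Matrix.mem_specialUnitaryGroup_iff.1 g.2).2

/-- Multiplication by the variable `x_i`, from `Sym^n` to `Sym^(n+1)`. -/
noncomputable def mulX (n : ℕ) (i : Fin 2) : S n →ₗ[ℂ] S (n + 1) :=
  ((LinearMap.mulLeft ℂ (X i)).comp (S n).subtype).codRestrict _ fun p => by
    have := (isHomogeneous_X ℂ i).mul p.2
    rwa [add_comm] at this

theorem coe_mulX (n : ℕ) (i : Fin 2) (p : S n) :
    (mulX n i p : MvPolynomial (Fin 2) ℂ) = X i * (p : MvPolynomial (Fin 2) ℂ) := rfl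

/-- The multiplication `ℂ² ⊗ Sym^n → Sym^(n+1)`. -/
noncomputable def symMul (n : ℕ) : (Fin 2 → ℂ) ⊗[ℂ] S n →ₗ[ℂ] S (n + 1) :=
  TensorProduct.lift (∑ i, (LinearMap.toSpanSingleton ℂ _ (mulX n i)).comp (LinearMap.proj i))

theorem symMul_tmul (n : ℕ) (v : Fin 2 → ℂ) (p : S n) :
    symMul n (v ⊗ₜ p) = v 0 • mulX n 0 p + v 1 • mulX n 1 p := by
  simp [symMul]

/-- The map `Sym^n → ℂ² ⊗ Sym^(n+1)`, `p ↦ e_0 ⊗ x_1 p - e_1 ⊗ x_0 p`. -/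
noncomputable def symWedge (n : ℕ) : S n →ₗ[ℂ] (Fin 2 → ℂ) ⊗[ℂ] S (n + 1) :=
  (TensorProduct.mk ℂ _ _ (e 0)).comp (mulX n 1) -
    (TensorProduct.mk ℂ _ _ (e 1)).comp (mulX n 0)

theorem symWedge_apply (n : ℕ) (p : S n) :
    symWedge n p = e 0 ⊗ₜ mulX n 1 p - e 1 ⊗ₜ mulX n 0 p := rfl

theorem exists_eq_tmul_add_tmul (n : ℕ) (w : (Fin 2 → ℂ) ⊗[ℂ] S n) :
    ∃ a b : S n, w = e 0 ⊗ₜ a + e 1 ⊗ₜ b := by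
  induction w with
  | zero => exact ⟨0, 0, by simp⟩
  | tmul v p =>
    refine ⟨v 0 • p, v 1 • p, ?_⟩
    rw [← smul_tmul, ← smul_tmul, ← add_tmul]
    congr 1
    ext i
    fin_cases i <;> simp
  | add x y hx hy =>
    obtain ⟨a, b, rfl⟩ := hx
    obtain ⟨c, d, rfl⟩ := hy
    exact ⟨a + c, b + d, by simp only [tmul_add]; abel⟩

theorem stdRep_single (g : SU2) (j : Fin 2) :
    stdRep g (e j) = (g : Matrix (Fin 2) (Fin 2) ℂ) 0 j • e 0 +
      (g : Matrix (Fin 2) (Fin 2) ℂ) 1 j • e 1 := by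
  ext i
  fin_cases i <;> simp [stdRep]

theorem symMul_isIntertwining (n : ℕ) (g : SU2) :
    symMul n ∘ₗ (stdRep.tprod (symPowRep n)) g = symPowRep (n + 1) g ∘ₗ symMul n := by
  ext1
  refine LinearMap.pi_ext' fun i => LinearMap.ext_ring (LinearMap.ext fun p => Subtype.ext ?_)
  change (symMul n (stdRep g (e i) ⊗ₜ symPowRep n g p) : MvPolynomial (Fin 2) ℂ) =
    symAlgRep g (symMul n (e i ⊗ₜ p))
  rw [stdRep_single, symMul_tmul, symMul_tmul]
  fin_cases i <;>
    simp [coe_mulX, coe_symPowRep, symAlgRep_mul, symAlgRep_X, actX, smul_eq_C_mul] <;> ring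

theorem symWedge_isIntertwining (n : ℕ) (g : SU2) :
    symWedge n ∘ₗ symPowRep n g = (stdRep.tprod (symPowRep (n + 1))) g ∘ₗ symWedge n := by
  ext1 p
  have h : ∀ j, symPowRep (n + 1) g (mulX n j p) =
      (g : Matrix (Fin 2) (Fin 2) ℂ) 0 j • mulX n 0 (symPowRep n g p) +
      (g : Matrix (Fin 2) (Fin 2) ℂ) 1 j • mulX n 1 (symPowRep n g p) := fun j => by
    apply Subtype.ext
    simp [coe_mulX, coe_symPowRep, symAlgRep_mul, symAlgRep_X, actX, smul_eq_C_mul]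
    ring
  simp only [LinearMap.coe_comp, Function.comp_apply, symWedge_apply, map_sub,
    Representation.tprod_apply, map_tmul, h, stdRep_single]
  simp only [tmul_add, add_tmul, tmul_smul, ← smul_tmul']
  have hdet := det_eq_one g
  generalize (g : Matrix (Fin 2) (Fin 2) ℂ) 0 0 = a at *
  generalize (g : Matrix (Fin 2) (Fin 2) ℂ) 1 0 = b at *
  generalize (g : Matrix (Fin 2) (Fin 2) ℂ) 0 1 = c at *
  generalize (g : Matrix (Fin 2) (Fin 2) ℂ) 1 1 = d at *
  -- The mixed terms cancel identically; the others carry the determinant as a factor.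
  match_scalars <;> first | ring1 | linear_combination hdet | linear_combination -hdet

theorem symMul_surjective (n : ℕ) : Function.Surjective (symMul n) := by
  rintro ⟨p, hp⟩
  suffices h : p ∈ (LinearMap.range (symMul n)).map (S (n + 1)).subtype by
    obtain ⟨_, ⟨w, rfl⟩, hw⟩ := h
    exact ⟨w, Subtype.ext hw⟩
  rw [← homogeneousSubmodule_one_pow, pow_succ', homogeneousSubmodule_one_pow] at hp
  refine Submodule.mul_induction_on hp (fun a ha b hb => ?_) fun x y hx hy => add_mem hx hy
  rw [homogeneousSubmodule_one_eq_span_X] at ha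
  induction ha using Submodule.span_induction with
  | mem x hx =>
    obtain ⟨i, rfl⟩ := hx
    refine ⟨mulX n i ⟨b, hb⟩, ⟨e i ⊗ₜ ⟨b, hb⟩, ?_⟩, rfl⟩
    fin_cases i <;> simp [symMul_tmul]
  | zero => simp
  | add x y _ _ hx hy => rw [add_mul]; exact add_mem hx hy
  | smul c x _ hx => rw [smul_mul_assoc]; exact Submodule.smul_mem _ c hx

theorem isHomogeneous_of_X_mul {n : ℕ} {i : Fin 2} {s : MvPolynomial (Fin 2) ℂ}
    (h : (X i * s).IsHomogeneous (n + 1)) : s.IsHomogeneous n := fun d hd => by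
  have := @h (Finsupp.single i 1 + d) (by rwa [coeff_X_mul])
  rw [map_add, Finsupp.weight_single] at this
  simp at this
  omega

/-- The Koszul relation: `X 1` divides `X 0 * p` and is prime to `X 0`, hence divides `p`. -/
theorem X_one_dvd_of_add_eq_zero {p q : MvPolynomial (Fin 2) ℂ} (h : X 0 * p + X 1 * q = 0) :
    ∃ s : MvPolynomial (Fin 2) ℂ, p = X 1 * s ∧ q = -(X 0 * s) := by
  have hdvd : (X 1 : MvPolynomial (Fin 2) ℂ) ∣ X 0 * p := ⟨-q, by linear_combination h⟩
  rw [X_dvd_mul_iff, X_dvd_X] at hdvd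
  obtain ⟨s, rfl⟩ := hdvd.resolve_left (by decide)
  exact ⟨s, rfl, mul_left_cancel₀ (X_ne_zero 1) (by linear_combination h)⟩

theorem symWedge_injective (n : ℕ) : Function.Injective (symWedge n) := by
  refine (injective_iff_map_eq_zero _).2 fun p hp => ?_
  have h := congrArg (TensorProduct.lid ℂ _ ∘ LinearMap.rTensor _ (LinearMap.proj (0 : Fin 2))) hp
  have h' : mulX n 1 p = 0 := by simpa [symWedge_apply] using h
  have h'' : (X 1 : MvPolynomial (Fin 2) ℂ) * (p : MvPolynomial (Fin 2) ℂ) = 0 :=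
    congrArg Subtype.val h'
  exact Subtype.ext ((mul_eq_zero.1 h'').resolve_left (X_ne_zero 1))

theorem symMul_eq_zero_iff (n : ℕ) (a b : S n) : symMul n (e 0 ⊗ₜ a + e 1 ⊗ₜ b) = 0 ↔
    X 0 * (a : MvPolynomial (Fin 2) ℂ) + X 1 * (b : MvPolynomial (Fin 2) ℂ) = 0 := by
  rw [← Subtype.coe_inj]
  simp [symMul_tmul, coe_mulX]

theorem exact_symWedge_symMul (n : ℕ) : Function.Exact (symWedge n) (symMul (n + 1)) := by
  intro w
  obtain ⟨a, b, rfl⟩ := exists_eq_tmul_add_tmul _ w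
  rw [symMul_eq_zero_iff]
  constructor
  · intro h
    obtain ⟨s, ha, hb⟩ := X_one_dvd_of_add_eq_zero h
    have hs : s.IsHomogeneous n := isHomogeneous_of_X_mul (i := 1) (ha ▸ a.2)
    refine ⟨⟨s, hs⟩, ?_⟩
    have ha' : a = mulX n 1 ⟨s, hs⟩ := Subtype.ext ha
    have hb' : b = -mulX n 0 ⟨s, hs⟩ := Subtype.ext hb
    rw [symWedge_apply, ha', hb', tmul_neg, sub_eq_add_neg]
  · rintro ⟨p, hp⟩
    rw [← symMul_eq_zero_iff, ← hp, symWedge_apply, ← Subtype.coe_inj]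
    simp [symMul_tmul, coe_mulX]
    ring

/-- A kernel element would come from some `s` with `X 1 * s` homogeneous of degree 0, which forces
`s = 0`. This replaces the exact sequence at the bottom degree. -/
theorem symMul_zero_injective : Function.Injective (symMul 0) := by
  refine (injective_iff_map_eq_zero _).2 fun w hw => ?_
  obtain ⟨a, b, rfl⟩ := exists_eq_tmul_add_tmul _ w
  rw [symMul_eq_zero_iff] at hw
  obtain ⟨s, ha, hb⟩ := X_one_dvd_of_add_eq_zero hw
  have hs : s = 0 := by
    by_contra hs
    have hX : (X 1 * s : MvPolynomial (Fin 2) ℂ) ≠ 0 := mul_ne_zero (X_ne_zero 1) hs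
    have h0 := IsHomogeneous.totalDegree (ha ▸ a.2 : (X 1 * s).IsHomogeneous 0) hX
    rw [totalDegree_mul_of_isDomain (X_ne_zero 1) hs, totalDegree_X] at h0
    omega
  have ha' : a = 0 := Subtype.ext (by simpa [hs] using ha)
  have hb' : b = 0 := Subtype.ext (by simpa [hs] using hb)
  simp [ha', hb']

/-- The restriction of an intertwining map to a subgroup. -/
noncomputable def restrictMap {W W' : Type} [AddCommGroup W] [Module ℂ W] [AddCommGroup W']
    [Module ℂ W'] {σ : Representation ℂ SU2 W} {σ' : Representation ℂ SU2 W'}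
    (G : Subgroup SU2) (f : W →ₗ[ℂ] W') (hf : ∀ g, f ∘ₗ σ g = σ' g ∘ₗ f) :
    (restrict σ G).IntertwiningMap (restrict σ' G) :=
  ⟨f, fun g => hf g⟩

variable (G : Subgroup SU2)

theorem character_std_mul_symPow_succ [Finite G] (n : ℕ) :
    (restrict stdRep G).character * (restrict (symPowRep (n + 1)) G).character =
      (restrict (symPowRep n) G).character + (restrict (symPowRep (n + 2)) G).character := by
  rw [← char_tensor]
  exact character_eq_add_of_exact
    (σ := restrict (stdRep.tprod (symPowRep (n + 1))) G)
    (restrictMap G (symWedge n) (symWedge_isIntertwining n))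
    (restrictMap G (symMul (n + 1)) (symMul_isIntertwining (n + 1)))
    (symWedge_injective n) (symMul_surjective (n + 1)) (exact_symWedge_symMul n)

theorem character_std_mul_symPow_zero :
    (restrict stdRep G).character * (restrict (symPowRep 0) G).character =
      (restrict (symPowRep 1) G).character := by
  rw [← char_tensor]
  exact char_iso (ρ := restrict (stdRep.tprod (symPowRep 0)) G)
    ((restrictMap G (symMul 0) (symMul_isIntertwining 0)).ofBijective
      ⟨symMul_zero_injective, symMul_surjective 0⟩)

theorem finrank_homogeneousSubmodule_zero : Module.finrank ℂ (S 0) = 1 := by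
  rw [homogeneousSubmodule_zero]
  refine finrank_eq_one_iff_of_nonzero' ⟨1, Submodule.one_le.1 le_rfl⟩ ?_ |>.2 ?_
  · simp
  · rintro ⟨w, hw⟩
    obtain ⟨c, rfl⟩ := Submodule.mem_one.1 hw
    exact ⟨c, Subtype.ext (Algebra.algebraMap_eq_smul_one c).symm⟩

theorem symPowRep_zero_apply (g : SU2) : symPowRep 0 g = LinearMap.id := by
  ext1 ⟨p, hp⟩
  apply Subtype.ext
  rw [homogeneousSubmodule_zero] at hp
  obtain ⟨c, rfl⟩ := Submodule.mem_one.1 hp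
  exact (aeval (actX g)).commutes c

theorem character_symPow_zero : (restrict (symPowRep 0) G).character = 1 := by
  ext g
  change LinearMap.trace ℂ _ (symPowRep 0 g) = 1
  rw [symPowRep_zero_apply, LinearMap.trace_id, finrank_homogeneousSubmodule_zero, Nat.cast_one]

end ClebschGordan

/-! ### The recurrence for multiplicities and the Kostant series -/

section Kostant

open Representation

variable {G : Subgroup SU2} [Finite G] {r : ℕ} {V : Fin (r + 1) → Type u}
  [∀ i, AddCommGroup (V i)] [∀ i, Module ℂ (V i)] {ρ : ∀ i, Representation ℂ G (V i)}

theorem IsIrrepList.character_zero (hρ : IsIrrepList ρ) : (ρ 0).character = 1 := by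
  have hirr := hρ.irreducible 0
  have htriv := hρ.trivial
  have hfin := finiteDimensional_of_isIrreducible _ hirr
  have h1 : Module.finrank ℂ (V 0) = 1 := by
    rw [← isSimpleModule_iff_finrank_eq_one, isSimpleModule_iff]
    -- Under a trivial action every subspace is invariant, so irreducibility means dimension one.
    have hsub : ∀ N : Submodule ℂ (V 0), ∀ g, ∀ v ∈ N, ρ 0 g v ∈ N := fun N g v hv => by
      rwa [isTrivial_apply]
    refine { exists_pair_ne := ⟨⊥, ⊤, fun h => ?_⟩, eq_bot_or_eq_top := fun N => ?_ }
    · exact bot_ne_top (Subrepresentation.toSubmodule_injective h :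
        (⊥ : Subrepresentation (ρ 0)) = ⊤)
    · exact (hirr.eq_bot_or_eq_top ⟨N, hsub N⟩).imp (congrArg Subrepresentation.toSubmodule)
        (congrArg Subrepresentation.toSubmodule)
  ext g
  rw [character, isTrivial_def, LinearMap.trace_id, h1]
  simp

theorem IsIrrepList.multiplicity_symPow_zero (hρ : IsIrrepList ρ) {i : Fin (r + 1)} (hi : i ≠ 0) :
    multiplicity (ρ i) (restrict (symPowRep 0) G) = 0 := by
  have hfin := fun i => finiteDimensional_of_isIrreducible _ (hρ.irreducible i)
  have h := hρ.multiplicity_eq i 0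
  rw [if_neg hi] at h
  have : (multiplicity (ρ i) (restrict (symPowRep 0) G) : ℂ) = 0 := by
    rw [multiplicity_eq_charInner, character_symPow_zero, ← hρ.character_zero,
      ← multiplicity_eq_charInner, h, Nat.cast_zero]
  exact_mod_cast this

/-- Decompose `σ` into the `ρ j` and tensor with `ℂ²`: both sides count `ρ i` in `ℂ² ⊗ σ`. -/
theorem IsIrrepList.sum_mckayMatrix_mul (hρ : IsIrrepList ρ) {W : Type} [AddCommGroup W]
    [Module ℂ W] [FiniteDimensional ℂ W] (σ : Representation ℂ G W) (i : Fin (r + 1)) :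
    ((∑ j, mckayMatrix G ρ j i * multiplicity (ρ j) σ : ℕ) : ℂ) =
      charInner ((restrict stdRep G).character * σ.character) (ρ i).character := by
  have hfin := fun i => finiteDimensional_of_isIrreducible _ (hρ.irreducible i)
  rw [hρ.character_eq_sum σ, Finset.mul_sum]
  simp_rw [mul_smul_comm]
  rw [charInner_sum_smul]
  push_cast
  refine Finset.sum_congr rfl fun j _ => ?_
  rw [mckayMatrix, multiplicity_eq_charInner (ρ i), char_tensor, mul_comm]

theorem IsIrrepList.sum_mckayMatrix_mul_symPow_succ (hρ : IsIrrepList ρ) (i : Fin (r + 1)) (n : ℕ) :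
    ∑ j, mckayMatrix G ρ j i * multiplicity (ρ j) (restrict (symPowRep (n + 1)) G) =
      multiplicity (ρ i) (restrict (symPowRep n) G) +
        multiplicity (ρ i) (restrict (symPowRep (n + 2)) G) := by
  have hfin := fun i => finiteDimensional_of_isIrreducible _ (hρ.irreducible i)
  apply Nat.cast_injective (R := ℂ)
  rw [hρ.sum_mckayMatrix_mul, character_std_mul_symPow_succ, charInner_add, Nat.cast_add,
    multiplicity_eq_charInner, multiplicity_eq_charInner]

theorem IsIrrepList.sum_mckayMatrix_mul_symPow_zero (hρ : IsIrrepList ρ) (i : Fin (r + 1)) :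
    ∑ j, mckayMatrix G ρ j i * multiplicity (ρ j) (restrict (symPowRep 0) G) =
      multiplicity (ρ i) (restrict (symPowRep 1) G) := by
  have hfin := fun i => finiteDimensional_of_isIrreducible _ (hρ.irreducible i)
  apply Nat.cast_injective (R := ℂ)
  rw [hρ.sum_mckayMatrix_mul, character_std_mul_symPow_zero, multiplicity_eq_charInner]

theorem IsIrrepList.kostantSeries_recurrence (hρ : IsIrrepList ρ) {i : Fin (r + 1)} (hi : i ≠ 0) :
    (HahnSeries.single 1 1 + HahnSeries.single (-1) 1) * kostantSeries G ρ i =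
      ∑ j, mckayMatrix G ρ j i • kostantSeries G ρ j := by
  set P : Fin (r + 1) → PowerSeries ℤ := fun j =>
    PowerSeries.mk fun n => (multiplicity (ρ j) (restrict (symPowRep n) G) : ℤ) with hP
  -- The identity multiplied by `t`, so that it lives in power series. Its constant coefficient is
  -- the one place where `i ≠ 0` enters.
  have hrec : (PowerSeries.X ^ 2 + 1) * P i =
      PowerSeries.X * ∑ j, mckayMatrix G ρ j i • P j := by
    have hcoeff : ∀ n, PowerSeries.coeff n (∑ j, mckayMatrix G ρ j i • P j) =
        ((∑ j, mckayMatrix G ρ j i * multiplicity (ρ j) (restrict (symPowRep n) G) : ℕ) : ℤ) := by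
      intro n
      rw [map_sum, Nat.cast_sum]
      refine Finset.sum_congr rfl fun j _ => ?_
      rw [map_nsmul, PowerSeries.coeff_mk, nsmul_eq_mul, Nat.cast_mul]
    ext n
    rw [add_mul, one_mul, map_add]
    match n with
    | 0 => simp [PowerSeries.coeff_X_pow_mul', hP, hρ.multiplicity_symPow_zero hi]
    | 1 =>
      rw [PowerSeries.coeff_X_pow_mul', PowerSeries.coeff_succ_X_mul, hcoeff,
        hρ.sum_mckayMatrix_mul_symPow_zero]
      simp [hP]
    | n + 2 =>
      rw [PowerSeries.coeff_X_pow_mul, PowerSeries.coeff_succ_X_mul, hcoeff,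
        hρ.sum_mckayMatrix_mul_symPow_succ]
      simp [hP]
  have hT : (HahnSeries.single 1 1 + HahnSeries.single (-1) 1 : LaurentSeries ℤ) =
      HahnSeries.single (-1) 1 * HahnSeries.ofPowerSeries ℤ ℤ (PowerSeries.X ^ 2 + 1) := by
    rw [map_add, map_pow, HahnSeries.ofPowerSeries_X,
      map_one (HahnSeries.ofPowerSeries ℤ ℤ), mul_add, HahnSeries.single_pow,
      HahnSeries.single_mul_single]
    simp
  change _ * HahnSeries.ofPowerSeries ℤ ℤ (P i) =
    ∑ j, mckayMatrix G ρ j i • HahnSeries.ofPowerSeries ℤ ℤ (P j)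
  rw [hT, mul_assoc, ← map_mul, hrec, map_mul, HahnSeries.ofPowerSeries_X, ← mul_assoc,
    HahnSeries.single_mul_single]
  simp

end Kostant

end McKay

namespace McKay
namespace Diagram

variable (Δ : Diagram)

/-! ### The invariant form -/

/-- The pairings `⟨x, α_i⟩` of `x` with the simple roots: the Cartan matrix applied to `x`. -/
def cartan (x : Fin Δ.rank → ℤ) (i : Fin Δ.rank) : ℤ := 2 * x i - ∑ j, Δ.adj i j * x j

/-- The invariant bilinear form. -/
def form (x y : Fin Δ.rank → ℤ) : ℤ := ∑ i, x i * Δ.cartan y i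

/-- The number of edges joining the vertices of the diagram with the affine vertex. -/
def affineAdj (i : Fin Δ.rank) : ℤ := (Δ.extAdj i.succ 0 : ℤ)

theorem extAdj_comm (i j : Fin (Δ.rank + 1)) : Δ.extAdj i j = Δ.extAdj j i :=
  add_comm _ _

theorem adj_comm (i j : Fin Δ.rank) : Δ.adj i j = Δ.adj j i := by
  rw [adj, adj, extAdj_comm]

theorem adj_nonneg (i j : Fin Δ.rank) : 0 ≤ Δ.adj i j := Int.natCast_nonneg _

theorem affineAdj_nonneg (i : Fin Δ.rank) : 0 ≤ Δ.affineAdj i := Int.natCast_nonneg _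

theorem cartan_sub (x y : Fin Δ.rank → ℤ) (i : Fin Δ.rank) :
    Δ.cartan (x - y) i = Δ.cartan x i - Δ.cartan y i := by
  simp only [cartan, Pi.sub_apply, mul_sub, Finset.sum_sub_distrib]
  ring

theorem form_comm (x y : Fin Δ.rank → ℤ) : Δ.form x y = Δ.form y x := by
  simp only [form, cartan, mul_sub, Finset.mul_sum, Finset.sum_sub_distrib]
  congr 1
  · exact Finset.sum_congr rfl fun _ _ => by ring
  · rw [Finset.sum_comm]
    exact Finset.sum_congr rfl fun i _ => Finset.sum_congr rfl fun j _ => by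
      rw [Δ.adj_comm]; ring

theorem form_sub_left (x y z : Fin Δ.rank → ℤ) : Δ.form (x - y) z = Δ.form x z - Δ.form y z := by
  simp [form, sub_mul, Finset.sum_sub_distrib]

theorem form_sub_sub (x y : Fin Δ.rank → ℤ) :
    Δ.form (x - y) (x - y) = Δ.form x x - 2 * Δ.form y x + Δ.form y y := by
  rw [form_sub_left, form_comm _ x, form_comm _ y, form_sub_left, form_sub_left, form_comm _ x y]
  ring

theorem form_single (k : Fin Δ.rank) (x : Fin Δ.rank → ℤ) :
    Δ.form (Pi.single k 1) x = Δ.cartan x k := by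
  simp [form, Pi.single_apply]

theorem form_smul_left (c : ℤ) (x y : Fin Δ.rank → ℤ) : Δ.form (c • x) y = c * Δ.form x y := by
  simp [form, Finset.mul_sum, mul_assoc]

theorem reflect_apply (S : Finset (Fin Δ.rank)) (x : Fin Δ.rank → ℤ) (i : Fin Δ.rank) :
    Δ.reflect S x i = x i - if i ∈ S then Δ.cartan x i else 0 := by
  simp only [reflect, cartan]
  split_ifs <;> ring

theorem adj_self (i : Fin Δ.rank) : Δ.adj i i = 0 := by
  obtain ⟨i, hi⟩ := i
  match Δ with
  | A m hm =>
    have hi : i < 2 * m - 1 := hi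
    have : ¬ i + 1 = (i + 1 + 1) % (2 * m) := by
      intro h
      rcases Nat.lt_or_ge (i + 1 + 1) (2 * m) with h' | h'
      · rw [Nat.mod_eq_of_lt h'] at h; omega
      · rw [show i + 1 + 1 = 2 * m by omega, Nat.mod_self] at h; omega
    simp [adj, extAdj, edge, this]
  | D n hn =>
    have : ¬ (i + 1 = n - 2 ∧ i + 1 = n) := by omega
    simp [adj, extAdj, edge, this]
  | E6 => revert i; decide
  | E7 => revert i; decide
  | E8 => revert i; decide

theorem form_single_self (k : Fin Δ.rank) :
    Δ.form (Pi.single k 1) (Pi.single k 1) = 2 := by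
  simp [form_single, cartan, Pi.single_apply, adj_self]

/-- Simple roots have norm 2 and reflections preserve the form. -/
theorem IsRoot.form_self {x : Fin Δ.rank → ℤ} (hx : Δ.IsRoot x) : Δ.form x x = 2 := by
  induction hx with
  | simple i => exact Δ.form_single_self i
  | reflect k x hx ih =>
    have h : Δ.reflect {k} x = x - Δ.cartan x k • Pi.single k 1 := by
      ext i
      by_cases hik : i = k
      · subst hik; simp [reflect_apply]
      · simp [reflect_apply, hik]
    rw [h, form_sub_sub, form_smul_left, form_smul_left, form_single,
      form_comm _ (Pi.single k 1), form_smul_left, form_single_self, ih]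
    ring

/-- The reflected root `s_i β` is again at most `β`. -/
theorem IsHighestRoot.cartan_nonneg {β : Fin Δ.rank → ℤ} (hβ : Δ.IsHighestRoot β)
    (i : Fin Δ.rank) : 0 ≤ Δ.cartan β i := by
  have h := hβ.2 _ (hβ.1.reflect i) i
  rw [reflect_apply, if_pos (Finset.mem_singleton_self i)] at h
  linarith

theorem IsHighestRoot.one_le {β : Fin Δ.rank → ℤ} (hβ : Δ.IsHighestRoot β)
    (i : Fin Δ.rank) : 1 ≤ β i := by
  have h := hβ.2 _ (IsRoot.simple i) i
  simpa using h

/-- The hypothesis says that `θ`, extended by 1 at the affine vertex, is killed by the affine Cartan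
matrix. Substituting `x_i = θ_i y_i` then turns the form into a sum of squares over the edges of the
extended diagram, with `y = 0` at the affine vertex. -/
theorem two_mul_form_self {θ : Fin Δ.rank → ℤ}
    (hθ : ∀ i, Δ.cartan θ i = Δ.affineAdj i) (x : Fin Δ.rank → ℤ) (y : Fin Δ.rank → ℚ)
    (hy : ∀ i, (x i : ℚ) = θ i * y i) :
    2 * (Δ.form x x : ℚ) = ∑ i, (2 * (Δ.affineAdj i * θ i * y i ^ 2) +
      ∑ j, Δ.adj i j * θ i * θ j * (y i - y j) ^ 2) := by
  have h1 : ∀ i, 2 * (θ i : ℚ) = Δ.affineAdj i + ∑ j, (Δ.adj i j : ℚ) * θ j := fun i => by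
    have := hθ i
    rw [cartan] at this
    have h2 : 2 * θ i = Δ.affineAdj i + ∑ j, Δ.adj i j * θ j := by linarith
    exact_mod_cast h2
  have hsym : ∑ i, ∑ j, (Δ.adj i j : ℚ) * θ i * θ j * y j ^ 2 =
      ∑ i, ∑ j, (Δ.adj i j : ℚ) * θ i * θ j * y i ^ 2 := by
    rw [Finset.sum_comm]
    exact Finset.sum_congr rfl fun i _ => Finset.sum_congr rfl fun j _ => by
      rw [Δ.adj_comm]; ring
  have h3 : (Δ.form x x : ℚ) = ∑ i, (Δ.affineAdj i * θ i * y i ^ 2 +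
      ∑ j, (Δ.adj i j : ℚ) * θ i * θ j * (y i ^ 2 - y i * y j)) := by
    simp only [form, cartan]
    push_cast
    refine Finset.sum_congr rfl fun i _ => ?_
    simp only [hy]
    have : (θ i : ℚ) * y i * (2 * (θ i * y i) - ∑ j, (Δ.adj i j : ℚ) * (θ j * y j)) =
      θ i * y i ^ 2 * (2 * θ i) - θ i * y i * ∑ j, (Δ.adj i j : ℚ) * (θ j * y j) := by ring
    rw [this, h1, mul_add, Finset.mul_sum, Finset.mul_sum, add_sub_assoc,
      ← Finset.sum_sub_distrib]
    congr 1
    · ring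
    · exact Finset.sum_congr rfl fun _ _ => by ring
  have h4 : ∑ i, ∑ j, (Δ.adj i j : ℚ) * θ i * θ j * (y i - y j) ^ 2 =
      2 * ∑ i, ∑ j, (Δ.adj i j : ℚ) * θ i * θ j * (y i ^ 2 - y i * y j) := by
    have : ∀ i j, (Δ.adj i j : ℚ) * θ i * θ j * (y i - y j) ^ 2 =
      2 * (Δ.adj i j * θ i * θ j * (y i ^ 2 - y i * y j)) +
        (Δ.adj i j * θ i * θ j * y j ^ 2 - Δ.adj i j * θ i * θ j * y i ^ 2) := fun i j => by ring
    simp only [this, Finset.sum_add_distrib, Finset.sum_sub_distrib, hsym, ← Finset.mul_sum]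
    ring
  rw [h3, Finset.sum_add_distrib, Finset.sum_add_distrib, h4, ← Finset.mul_sum]
  ring

/-- All squares must vanish: `y` is equal at adjacent vertices and zero next to the affine one.
Hence the pairing of `x` at `i` is `y i` times that of `θ`, which is `y i * affineAdj i = 0`.
Connectedness of the diagram is not needed. -/
theorem cartan_eq_zero_of_form_nonpos {θ : Fin Δ.rank → ℤ} (hpos : ∀ i, 0 < θ i)
    (hθ : ∀ i, Δ.cartan θ i = Δ.affineAdj i) {x : Fin Δ.rank → ℤ} (hx : Δ.form x x ≤ 0)
    (i : Fin Δ.rank) : Δ.cartan x i = 0 := by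
  have hpos' : ∀ i, (0 : ℚ) < θ i := fun i => by exact_mod_cast hpos i
  have hadj : ∀ i j, (0 : ℚ) ≤ Δ.adj i j := fun i j => by exact_mod_cast Δ.adj_nonneg i j
  have haff : ∀ i, (0 : ℚ) ≤ Δ.affineAdj i := fun i => by exact_mod_cast Δ.affineAdj_nonneg i
  set y : Fin Δ.rank → ℚ := fun i => x i / θ i with hydef
  have hy : ∀ i, (x i : ℚ) = θ i * y i := fun i => by
    rw [hydef]; field_simp [(hpos' i).ne']
  have hterm : ∀ i j, (0 : ℚ) ≤ Δ.adj i j * θ i * θ j * (y i - y j) ^ 2 := fun i j =>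
    mul_nonneg (mul_nonneg (mul_nonneg (hadj i j) (hpos' i).le) (hpos' j).le) (sq_nonneg _)
  have haffterm : ∀ i, (0 : ℚ) ≤ 2 * (Δ.affineAdj i * θ i * y i ^ 2) := fun i =>
    mul_nonneg zero_le_two (mul_nonneg (mul_nonneg (haff i) (hpos' i).le) (sq_nonneg _))
  have hsum := Δ.two_mul_form_self hθ x y hy
  have hnn : ∀ i, (0 : ℚ) ≤ 2 * (Δ.affineAdj i * θ i * y i ^ 2) +
      ∑ j, Δ.adj i j * θ i * θ j * (y i - y j) ^ 2 := fun i =>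
    add_nonneg (haffterm i) (Finset.sum_nonneg fun j _ => hterm i j)
  have hx' : (Δ.form x x : ℚ) ≤ 0 := by exact_mod_cast hx
  have hzero : ∑ i, (2 * (Δ.affineAdj i * θ i * y i ^ 2) +
      ∑ j, Δ.adj i j * θ i * θ j * (y i - y j) ^ 2) = (0 : ℚ) :=
    le_antisymm (by linarith) (Finset.sum_nonneg fun i _ => hnn i)
  have hi := (Finset.sum_eq_zero_iff_of_nonneg fun i _ => hnn i).1 hzero i (Finset.mem_univ i)
  have hi2 := (add_eq_zero_iff_of_nonneg (haffterm i)
    (Finset.sum_nonneg fun j _ => hterm i j)).1 hi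
  have hj : ∀ j, (Δ.adj i j : ℚ) * y j = Δ.adj i j * y i := fun j => by
    have := (Finset.sum_eq_zero_iff_of_nonneg fun j _ => hterm i j).1 hi2.2 j (Finset.mem_univ j)
    simp only [mul_eq_zero, (hpos' i).ne', (hpos' j).ne', or_false,
      pow_eq_zero_iff two_ne_zero] at this
    rcases this with h | h
    · rw [h]; ring
    · rw [sub_eq_zero.1 h]
  have hv : (Δ.affineAdj i : ℚ) * y i = 0 := by
    have := hi2.1
    simp only [mul_eq_zero, (hpos' i).ne', or_false, pow_eq_zero_iff two_ne_zero, two_ne_zero,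
      false_or] at this
    rwa [mul_eq_zero]
  have hθi : 2 * (θ i : ℚ) - ∑ j, (Δ.adj i j : ℚ) * θ j = Δ.affineAdj i := by exact_mod_cast hθ i
  have : (Δ.cartan x i : ℚ) = 0 := by
    rw [cartan]
    push_cast
    simp only [hy]
    have hs : ∑ j, (Δ.adj i j : ℚ) * (θ j * y j) = y i * ∑ j, (Δ.adj i j : ℚ) * θ j := by
      rw [Finset.mul_sum]
      refine Finset.sum_congr rfl fun j _ => ?_
      linear_combination (θ j : ℚ) * hj j
    rw [hs]
    linear_combination y i * hθi + hv
  exact_mod_cast this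

/-! ### The alternating products -/

/-- The differences `τ^(n) β - τ^(n+1) β`. -/
def tauDiff (Y : Finset (Fin Δ.rank)) (β : Fin Δ.rank → ℤ) (n : ℕ) : Fin Δ.rank → ℤ :=
  Δ.tau Y n β - Δ.tau Y (n + 1) β

/-- The colour class of the reflections in the factor number `n` of the alternating product. -/
def colourClass (Y : Finset (Fin Δ.rank)) (n : ℕ) : Finset (Fin Δ.rank) :=
  if Even n then Y else Yᶜ

variable {Δ} {Y : Finset (Fin Δ.rank)} {β : Fin Δ.rank → ℤ}

theorem mem_colourClass_succ (n : ℕ) (i : Fin Δ.rank) :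
    i ∈ Δ.colourClass Y (n + 1) ↔ i ∉ Δ.colourClass Y n := by
  by_cases h : Even n <;> simp [colourClass, h, Nat.even_add_one]

theorem tauDiff_apply (n : ℕ) (i : Fin Δ.rank) :
    Δ.tauDiff Y β n i = if i ∈ Δ.colourClass Y n then Δ.cartan (Δ.tau Y n β) i else 0 := by
  have : Δ.tau Y (n + 1) β = Δ.reflect (Δ.colourClass Y n) (Δ.tau Y n β) := by
    rw [tau, colourClass]; split_ifs <;> rfl
  rw [tauDiff, Pi.sub_apply, this, reflect_apply]
  ring

theorem tauDiff_eq_zero {n : ℕ} {i : Fin Δ.rank} (h : i ∉ Δ.colourClass Y n) :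
    Δ.tauDiff Y β n i = 0 := by
  rw [tauDiff_apply, if_neg h]

theorem cartan_tau_succ (n : ℕ) (i : Fin Δ.rank) :
    Δ.cartan (Δ.tau Y (n + 1) β) i = Δ.cartan (Δ.tau Y n β) i - Δ.cartan (Δ.tauDiff Y β n) i := by
  rw [← cartan_sub, tauDiff, sub_sub_cancel]

/-- The difference number `n` is supported on colour class `n`, and neighbours of that class lie
outside it. -/
theorem IsBipartition.sum_adj_tauDiff_eq_zero (hY : Δ.IsBipartition Y) {n : ℕ} {i : Fin Δ.rank}
    (h : i ∈ Δ.colourClass Y n) : ∑ j, Δ.adj i j * Δ.tauDiff Y β n j = 0 := by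
  refine Finset.sum_eq_zero fun j _ => ?_
  by_cases ha : Δ.adj i j = 0
  · rw [ha, zero_mul]
  have hij := hY i j ha
  have : j ∉ Δ.colourClass Y n := by
    unfold colourClass at h ⊢
    split_ifs at h ⊢
    · exact hij.1 h
    · simpa using mt hij.2 (Finset.mem_compl.1 h)
  rw [tauDiff_eq_zero this, mul_zero]

/-- On class `n`, two steps change the pairing `d n` by `-2 * d n` and by the neighbour sum of `d
(n+1)`. Off that class all terms vanish. -/
theorem IsBipartition.tauDiff_add_two (hY : Δ.IsBipartition Y) (n : ℕ) (i : Fin Δ.rank) :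
    Δ.tauDiff Y β n i + Δ.tauDiff Y β (n + 2) i = ∑ j, Δ.adj i j * Δ.tauDiff Y β (n + 1) j := by
  by_cases h : i ∈ Δ.colourClass Y n
  · have h1 : i ∉ Δ.colourClass Y (n + 1) := by rw [mem_colourClass_succ]; exact not_not_intro h
    have h2 : i ∈ Δ.colourClass Y (n + 2) := by rwa [mem_colourClass_succ]
    have hd : Δ.tauDiff Y β n i = Δ.cartan (Δ.tau Y n β) i := by rw [tauDiff_apply, if_pos h]
    rw [tauDiff_apply (n + 2), if_pos h2, cartan_tau_succ, cartan_tau_succ, ← hd,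
      cartan, cartan, hY.sum_adj_tauDiff_eq_zero h, tauDiff_eq_zero h1]
    ring
  · have h1 : i ∈ Δ.colourClass Y (n + 1) := by rwa [mem_colourClass_succ]
    have h2 : i ∉ Δ.colourClass Y (n + 2) := by rw [mem_colourClass_succ]; exact not_not_intro h1
    rw [tauDiff_eq_zero h, tauDiff_eq_zero h2, hY.sum_adj_tauDiff_eq_zero h1, add_zero]

theorem cartan_eq_zero_of_reflect_compl (hβ : Δ.reflect Yᶜ β = β) {i : Fin Δ.rank} (hi : i ∉ Y) :
    Δ.cartan β i = 0 := by
  have := congrFun hβ i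
  rw [reflect_apply, if_pos (by simpa using hi)] at this
  linarith

theorem tauDiff_zero (hβ : Δ.reflect Yᶜ β = β) (i : Fin Δ.rank) :
    Δ.tauDiff Y β 0 i = Δ.cartan β i := by
  rw [tauDiff_apply]
  by_cases hi : i ∈ Y
  · simp [colourClass, hi, tau]
  · simp [colourClass, hi, cartan_eq_zero_of_reflect_compl hβ hi]

/-- The recurrence one step earlier, with the difference before `d 0` equal to zero because `w₂ β =
β`. -/
theorem IsBipartition.tauDiff_one (hY : Δ.IsBipartition Y) (hβ : Δ.reflect Yᶜ β = β)
    (i : Fin Δ.rank) : Δ.tauDiff Y β 1 i = ∑ j, Δ.adj i j * Δ.tauDiff Y β 0 j := by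
  by_cases hi : i ∈ Y
  · have h0 : i ∈ Δ.colourClass Y 0 := by simpa [colourClass] using hi
    have h1 : i ∉ Δ.colourClass Y 1 := by simpa [colourClass] using hi
    rw [tauDiff_eq_zero h1, hY.sum_adj_tauDiff_eq_zero h0]
  · have h0 : i ∉ Δ.colourClass Y 0 := by simpa [colourClass] using hi
    have h1 : i ∈ Δ.colourClass Y 1 := by simpa [colourClass] using hi
    rw [tauDiff_apply, if_pos h1, cartan_tau_succ, tau, cartan_eq_zero_of_reflect_compl hβ hi,
      cartan, tauDiff_eq_zero h0]
    ring

end Diagram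
end McKay

namespace McKay
namespace Diagram

/-! ### The diagrams in coordinates -/

theorem sum_fin_ite_eq {r : ℕ} (f : ℕ → ℤ) (a : ℕ) :
    ∑ j : Fin r, (if (j : ℕ) = a then 1 else 0) * f j = if a < r then f a else 0 := by
  rw [Fin.sum_univ_eq_sum_range (fun j => (if j = a then 1 else 0) * f j)]
  simp

theorem adj_A (m : ℕ) (hm : 1 ≤ m) (i j : Fin (A m hm).rank) :
    (A m hm).adj i j = (if (j : ℕ) = i + 1 then 1 else 0) + if (i : ℕ) = j + 1 then 1 else 0 := by
  have hi : (i : ℕ) < 2 * m - 1 := i.2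
  have hj : (j : ℕ) < 2 * m - 1 := j.2
  have key : ∀ a b : ℕ, a < 2 * m - 1 → b < 2 * m - 1 →
      (b + 1 = (a + 1 + 1) % (2 * m) ↔ b = a + 1) := by
    intro a b ha hb
    rcases Nat.lt_or_ge (a + 1 + 1) (2 * m) with h' | h'
    · rw [Nat.mod_eq_of_lt h']; omega
    · rw [show a + 1 + 1 = 2 * m by omega, Nat.mod_self]; omega
  simp [adj, extAdj, edge, key _ _ hi hj, key _ _ hj hi]

theorem sum_adj_A (m : ℕ) (hm : 1 ≤ m) (f : ℕ → ℤ) (hf : f 0 = 0) (hf' : f (2 * m) = 0)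
    (i : Fin (A m hm).rank) :
    ∑ j, (A m hm).adj i j * f (j + 1) = f i + f (i + 2) := by
  have hi : (i : ℕ) < 2 * m - 1 := i.2
  have hr : (A m hm).rank = 2 * m - 1 := rfl
  simp only [adj_A, add_mul, Finset.sum_add_distrib]
  rw [sum_fin_ite_eq (fun j => f (j + 1)), add_comm]
  congr 1
  · obtain h | ⟨a, ha⟩ : (i : ℕ) = 0 ∨ ∃ a, (i : ℕ) = a + 1 :=
      (Nat.eq_zero_or_eq_succ_pred _).imp_right fun h => ⟨_, h⟩
    · simp [h, hf]
    · have : ∀ j : ℕ, (a + 1 = j + 1) = (j = a) := fun j => by rw [eq_iff_iff]; omega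
      simp only [ha, this]
      rw [sum_fin_ite_eq (fun j => f (j + 1)), if_pos (by omega)]
  · split_ifs with h
    · rfl
    · rw [show (i : ℕ) + 2 = 2 * m by omega, hf']

theorem affineAdj_A (m : ℕ) (hm : 1 ≤ m) (i : Fin (A m hm).rank) :
    (A m hm).affineAdj i =
      (if (i : ℕ) = 0 then 1 else 0) + if (i : ℕ) + 2 = 2 * m then 1 else 0 := by
  have hi : (i : ℕ) < 2 * m - 1 := i.2
  have h1 : (0 = ((i : ℕ) + 1 + 1) % (2 * m)) ↔ (i : ℕ) + 2 = 2 * m := by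
    rcases Nat.lt_or_ge (i + 1 + 1) (2 * m) with h' | h'
    · rw [Nat.mod_eq_of_lt h']; omega
    · rw [show (i : ℕ) + 1 + 1 = 2 * m by omega, Nat.mod_self]; omega
  have h2 : 1 % (2 * m) = 1 := Nat.mod_eq_of_lt (by omega)
  simp [affineAdj, extAdj, edge, h1, h2]
  ring

theorem adj_D (n : ℕ) (hn : 4 ≤ n) (i j : Fin (D n hn).rank) :
    (D n hn).adj i j =
      (if (j : ℕ) = i + 1 ∧ (j : ℕ) + 2 ≤ n ∨ (i : ℕ) + 3 = n ∧ (j : ℕ) + 1 = n then 1 else 0) +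
      if (i : ℕ) = j + 1 ∧ (i : ℕ) + 2 ≤ n ∨ (j : ℕ) + 3 = n ∧ (i : ℕ) + 1 = n then 1 else 0 := by
  have key : ∀ a b : ℕ, ((1 ≤ a + 1 ∧ b + 1 = a + 1 + 1 ∧ b + 1 ≤ n - 1) ∨
      (a + 1 = n - 2 ∧ b + 1 = n) ∨ (a + 1 = 0 ∧ b + 1 = 2)) =
      (b = a + 1 ∧ b + 2 ≤ n ∨ a + 3 = n ∧ b + 1 = n) := by
    intro a b
    rw [eq_iff_iff]
    omega
  simp only [adj, extAdj, edge, Fin.val_succ, key]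
  push_cast
  rfl

theorem sum_adj_D (n : ℕ) (hn : 4 ≤ n) (f : ℕ → ℤ) (hf : f 0 = 0) (i : Fin (D n hn).rank) :
    ∑ j, (D n hn).adj i j * f (j + 1) =
      if (i : ℕ) + 3 < n then f i + f (i + 2)
      else if (i : ℕ) + 3 = n then f i + f (i + 2) + f (i + 3) else f (n - 2) := by
  have hi : (i : ℕ) < n := i.2
  have hr : (D n hn).rank = n := rfl
  have hadj := adj_D n hn i
  have hlt : ∀ j : Fin (D n hn).rank, (j : ℕ) < n := fun j => j.2
  have hsum := sum_fin_ite_eq (r := (D n hn).rank) (fun j => f (j + 1))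
  rcases Nat.eq_zero_or_pos i with h0 | h0
  · have : ∀ j, (D n hn).adj i j = if (j : ℕ) = 1 then 1 else 0 := fun j => by
      have := hlt j
      rw [hadj]; split_ifs <;> omega
    simp only [this, hsum]
    rw [if_pos (by omega), if_pos (by omega), h0, hf]
    simp
  obtain ⟨a, ha⟩ : ∃ a, (i : ℕ) = a + 1 := ⟨i - 1, by omega⟩
  rcases Nat.lt_or_ge (i + 3) n with h3 | h3
  · have : ∀ j, (D n hn).adj i j =
        (if (j : ℕ) = a then 1 else 0) + if (j : ℕ) = a + 2 then 1 else 0 := fun j => by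
      have := hlt j
      rw [hadj]; split_ifs <;> omega
    simp only [this, add_mul, Finset.sum_add_distrib, hsum]
    rw [if_pos (by omega), if_pos (by omega), if_pos (by omega), ha]
  rcases h3.eq_or_lt with h3 | h3
  · have : ∀ j, (D n hn).adj i j = (if (j : ℕ) = a then 1 else 0) +
        (if (j : ℕ) = a + 2 then 1 else 0) + if (j : ℕ) = a + 3 then 1 else 0 := fun j => by
      have := hlt j
      rw [hadj]; split_ifs <;> omega
    simp only [this, add_mul, Finset.sum_add_distrib, hsum]
    rw [if_pos (by omega), if_pos (by omega), if_pos (by omega), if_neg (by omega),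
      if_pos (by omega), ha]
  · have : ∀ j, (D n hn).adj i j = if (j : ℕ) = n - 3 then 1 else 0 := fun j => by
      have := hlt j
      rw [hadj]; split_ifs <;> omega
    simp only [this, hsum]
    rw [if_pos (by omega), if_neg (by omega), if_neg (by omega)]
    congr 1
    omega

theorem affineAdj_D (n : ℕ) (hn : 4 ≤ n) (i : Fin (D n hn).rank) :
    (D n hn).affineAdj i = if (i : ℕ) = 1 then 1 else 0 := by
  have hi : (i : ℕ) < n := i.2
  have h1 : ¬ 0 = n - 2 := by omega
  have h2 : ¬ 0 = n := by omega
  simp [affineAdj, extAdj, edge, h1, h2]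

/-- Extension by zero to the positions `0` and `r + 1`, in the numbering of vertices from 1, removes
the boundary cases from neighbour sums along a chain. -/
theorem exists_nat_extension {r : ℕ} (x : Fin r → ℤ) :
    ∃ f : ℕ → ℤ, f 0 = 0 ∧ f (r + 1) = 0 ∧ x = fun i : Fin r => f (i + 1) := by
  refine ⟨fun k => if h : 1 ≤ k ∧ k - 1 < r then x ⟨k - 1, h.2⟩ else 0, by simp, by simp, ?_⟩
  ext i
  simp

/-! ### The marks -/

/-- These are the coefficients of the highest root, but `θ` need not be known to be a root: the last
condition, norm 2, suffices for the comparison with `β`. -/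
theorem exists_marks (Δ : Diagram) : ∃ θ : Fin Δ.rank → ℤ, (∀ i, 0 < θ i) ∧
    (∀ i, Δ.cartan θ i = Δ.affineAdj i) ∧ ∑ i, θ i * Δ.affineAdj i = 2 := by
  match Δ with
  | A m hm =>
    have hr : (A m hm).rank = 2 * m - 1 := rfl
    let f : ℕ → ℤ := fun k => if k = 0 ∨ k = 2 * m then 0 else 1
    have hf : ∀ i : Fin (A m hm).rank, f (i + 1) = 1 := fun i => by
      have := i.2
      simp only [f]
      rw [if_neg (by omega)]
    refine ⟨fun i => f (i + 1), fun i => by simp [hf], fun i => ?_, ?_⟩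
    · have := i.2
      rw [cartan, sum_adj_A m hm f (by simp [f]) (by simp [f]), affineAdj_A, hf]
      simp only [f]
      split_ifs <;> first | omega | tauto
    · have h2 : ∀ i : ℕ, (i + 2 = 2 * m) = (i = 2 * m - 2) := fun i => by rw [eq_iff_iff]; omega
      simp only [hf, one_mul, affineAdj_A, h2, Finset.sum_add_distrib]
      have hs := fun a => sum_fin_ite_eq (r := (A m hm).rank) (fun _ => 1) a
      simp only [mul_one] at hs
      rw [hs, hs, if_pos (by omega), if_pos (by omega)]
      rfl
  | D n hn =>
    have hr : (D n hn).rank = n := rfl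
    let f : ℕ → ℤ := fun k => if k = 0 then 0 else if k = 1 ∨ n ≤ k + 1 then 1 else 2
    refine ⟨fun i => f (i + 1), fun i => ?_, fun i => ?_, ?_⟩
    · simp only [f]
      split_ifs <;> first | omega | tauto
    · have := i.2
      rw [cartan, sum_adj_D n hn f (by simp [f]), affineAdj_D]
      simp only [f]
      split_ifs <;> first | omega | tauto
    · simp only [affineAdj_D]
      simp only [mul_comm (f _)]
      rw [sum_fin_ite_eq (r := (D n hn).rank) (fun i => f (i + 1)), if_pos (by omega)]
      simp only [f]
      split_ifs <;> first | omega | tauto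
  | E6 => exact ⟨fun i => [1, 2, 2, 3, 2, 1].getD i 0, by decide, by decide, by decide⟩
  | E7 => exact ⟨fun i => [2, 2, 3, 4, 3, 2, 1].getD i 0, by decide, by decide, by decide⟩
  | E8 => exact ⟨fun i => [2, 3, 4, 6, 5, 4, 3, 2].getD i 0, by decide, by decide, by decide⟩

theorem two_le_sum_mul_affineAdj_E6 {x : Fin E6.rank → ℤ} (hx : ∀ i, 1 ≤ x i)
    (hdom : ∀ i, 0 ≤ E6.cartan x i) : 2 ≤ ∑ i, x i * E6.affineAdj i := by
  have hadj : ∀ i j, E6.adj i j =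
    ((E6.edge (i + 1) (j + 1) + E6.edge (j + 1) (i + 1) : ℕ) : ℤ) := fun _ _ => rfl
  have haff : ∀ i, E6.affineAdj i =
    ((E6.edge (i + 1) 0 + E6.edge 0 (i + 1) : ℕ) : ℤ) := fun _ => rfl
  simp only [cartan, hadj, haff] at hdom ⊢
  change Fin 6 → ℤ at x
  change ∀ i : Fin 6, 1 ≤ x i at hx
  change ∀ i : Fin 6, 0 ≤ 2 * x i - ∑ j : Fin 6, _ * x j at hdom
  change 2 ≤ ∑ i : Fin 6, x i * _
  simp [Fin.forall_fin_succ, Fin.sum_univ_succ, edge] at hdom hx ⊢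
  by_contra! h
  -- If the vertex next to the affine one has coefficient 1, dominance there bounds the coefficient
  -- of the branch vertex by 2.
  obtain h3 | h3 : x 3 = 1 ∨ x 3 = 2 := by omega
  · omega
  · omega

theorem two_le_sum_mul_affineAdj_E7 {x : Fin E7.rank → ℤ} (hx : ∀ i, 1 ≤ x i)
    (hdom : ∀ i, 0 ≤ E7.cartan x i) : 2 ≤ ∑ i, x i * E7.affineAdj i := by
  have hadj : ∀ i j, E7.adj i j =
    ((E7.edge (i + 1) (j + 1) + E7.edge (j + 1) (i + 1) : ℕ) : ℤ) := fun _ _ => rfl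
  have haff : ∀ i, E7.affineAdj i =
    ((E7.edge (i + 1) 0 + E7.edge 0 (i + 1) : ℕ) : ℤ) := fun _ => rfl
  simp only [cartan, hadj, haff] at hdom ⊢
  change Fin 7 → ℤ at x
  change ∀ i : Fin 7, 1 ≤ x i at hx
  change ∀ i : Fin 7, 0 ≤ 2 * x i - ∑ j : Fin 7, _ * x j at hdom
  change 2 ≤ ∑ i : Fin 7, x i * _
  simp [Fin.forall_fin_succ, Fin.sum_univ_succ, edge] at hdom hx ⊢
  omega

theorem two_le_sum_mul_affineAdj_E8 {x : Fin E8.rank → ℤ} (hx : ∀ i, 1 ≤ x i)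
    (hdom : ∀ i, 0 ≤ E8.cartan x i) : 2 ≤ ∑ i, x i * E8.affineAdj i := by
  have hadj : ∀ i j, E8.adj i j =
    ((E8.edge (i + 1) (j + 1) + E8.edge (j + 1) (i + 1) : ℕ) : ℤ) := fun _ _ => rfl
  have haff : ∀ i, E8.affineAdj i =
    ((E8.edge (i + 1) 0 + E8.edge 0 (i + 1) : ℕ) : ℤ) := fun _ => rfl
  simp only [cartan, hadj, haff] at hdom ⊢
  change Fin 8 → ℤ at x
  change ∀ i : Fin 8, 1 ≤ x i at hx
  change ∀ i : Fin 8, 0 ≤ 2 * x i - ∑ j : Fin 8, _ * x j at hdom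
  change 2 ≤ ∑ i : Fin 8, x i * _
  simp [Fin.forall_fin_succ, Fin.sum_univ_succ, edge] at hdom hx ⊢
  -- The weights are the marks of `E8`. The marked sum of the pairings of `x` collapses to `x 7`,
  -- and it cannot be 1 because every mark is at least 2.
  have key : ∀ c₁ c₂ c₃ c₄ c₅ c₆ c₇ c₈ : ℤ, 0 ≤ c₁ → 0 ≤ c₂ → 0 ≤ c₃ → 0 ≤ c₄ → 0 ≤ c₅ → 0 ≤ c₆ →
      0 ≤ c₇ → 0 ≤ c₈ →
      2 * c₁ + 3 * c₂ + 4 * c₃ + 6 * c₄ + 5 * c₅ + 4 * c₆ + 3 * c₇ + 2 * c₈ ≠ 1 := by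
    intros
    omega
  have := key (2 * x 0 - x 2) (2 * x 1 - x 3) (2 * x 2 - x 0 - x 3)
    (2 * x 3 - x 1 - x 2 - x 4) (2 * x 4 - x 3 - x 5) (2 * x 5 - x 4 - x 6)
    (2 * x 6 - x 5 - x 7) (2 * x 7 - x 6) (by omega) (by omega) (by omega) (by omega)
    (by omega) (by omega) (by omega) (by omega)
  omega

/-- The sum is the inner product of `x` with `θ`. Applied to `x = β` it gives the inequality that
forces `β` and `θ` to have the same pairings. -/
theorem two_le_sum_mul_affineAdj (Δ : Diagram) {x : Fin Δ.rank → ℤ} (hx : ∀ i, 1 ≤ x i)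
    (hdom : ∀ i, 0 ≤ Δ.cartan x i) : 2 ≤ ∑ i, x i * Δ.affineAdj i := by
  match Δ with
  | A m hm =>
    have hr : (A m hm).rank = 2 * m - 1 := rfl
    obtain ⟨f, -, -, rfl⟩ := exists_nat_extension x
    have h2 : ∀ i : ℕ, (i + 2 = 2 * m) = (i = 2 * m - 2) := fun i => by rw [eq_iff_iff]; omega
    simp only [affineAdj_A, h2, mul_comm (f _), add_mul, Finset.sum_add_distrib]
    have hs := fun a => sum_fin_ite_eq (r := (A m hm).rank) (fun i => f (i + 1)) a
    rw [hs, hs, if_pos (by omega), if_pos (by omega)]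
    have h3 := hx ⟨0, by omega⟩
    have h4 := hx ⟨2 * m - 2, by omega⟩
    simp only at h3 h4
    linarith
  | D n hn =>
    have hr : (D n hn).rank = n := rfl
    obtain ⟨f, hf0, -, rfl⟩ := exists_nat_extension x
    simp only [affineAdj_D, mul_comm (f _)]
    rw [sum_fin_ite_eq (r := (D n hn).rank) (fun i => f (i + 1)), if_pos (by omega)]
    by_contra! hlt
    have hx' : ∀ k, k < n → 1 ≤ f (k + 1) := fun k hk => hx ⟨k, hk⟩
    have hd : ∀ k, k < n → 0 ≤ 2 * f (k + 1) - if k + 3 < n then f k + f (k + 2)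
        else if k + 3 = n then f k + f (k + 2) + f (k + 3) else f (n - 2) := fun k hk => by
      have := hdom ⟨k, hk⟩
      rwa [cartan, sum_adj_D n hn f hf0] at this
    -- A coefficient 1 at vertex 2 propagates by dominance along the chain to the branch vertex,
    -- which then has three neighbours of coefficient at least 1, too many for dominance.
    have hone : ∀ k, k + 3 ≤ n → f (k + 1) = 1 := by
      have h2 : f 2 = 1 := le_antisymm (by simpa using Int.lt_add_one_iff.1 hlt) (hx' 1 (by omega))
      intro k
      induction k using Nat.strong_induction_on with
      | _ k ih =>
        intro hk
        match k with
        | 0 =>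
          have h := hd 1 (by omega)
          have h3 := hx' 0 (by omega)
          have h4 := hx' 2 (by omega)
          have h5 := hx' 3 (by omega)
          simp only [Nat.reduceAdd] at *
          split_ifs at h <;> omega
        | 1 => exact h2
        | k + 2 =>
          have h := hd (k + 1) (by omega)
          rw [if_pos (by omega), ih k (by omega) (by omega), ih (k + 1) (by omega) (by omega)] at h
          have h4 := hx' (k + 2) (by omega)
          have h5 : 0 ≤ 2 * 1 - (1 + f (k + 2 + 1)) := h
          omega
    have h1 := hd (n - 3) (by omega)
    rw [if_neg (by omega), if_pos (by omega), hone (n - 3) (by omega)] at h1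
    have h2 := hx' (n - 4) (by omega)
    have h3 := hx' (n - 2) (by omega)
    have h4 := hx' (n - 1) (by omega)
    rw [show n - 4 + 1 = n - 3 by omega] at h2
    rw [show n - 2 + 1 = n - 3 + 2 by omega] at h3
    rw [show n - 1 + 1 = n - 3 + 3 by omega] at h4
    linarith
  | E6 => exact two_le_sum_mul_affineAdj_E6 hx hdom
  | E7 => exact two_le_sum_mul_affineAdj_E7 hx hdom
  | E8 => exact two_le_sum_mul_affineAdj_E8 hx hdom

/-! ### The solution of the recurrence -/

-- The explicit sequences are symmetric under `k ↦ h - k`, so the values at `h - 1` and `h` mirror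
-- those at 1 and 0.
set_option maxRecDepth 10000 in
theorem exists_recurrence_solution (Δ : Diagram) : ∃ c : ℕ → Fin Δ.rank → ℤ,
    c 0 = 0 ∧ c 1 = Δ.affineAdj ∧ c Δ.coxeterNumber = 0 ∧
    c (Δ.coxeterNumber - 1) = Δ.affineAdj ∧
    ∀ k, k + 2 ≤ Δ.coxeterNumber → ∀ i, ∑ j, Δ.adj i j * c (k + 1) j = c k i + c (k + 2) i := by
  match Δ with
  | A m hm =>
    have hr : (A m hm).rank = 2 * m - 1 := rfl
    have hh : (A m hm).coxeterNumber = 2 * m := rfl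
    -- Two unit pulses start at the two ends of the chain and cross it in opposite directions.
    let f : ℕ → ℕ → ℤ := fun k a => (if a = k then 1 else 0) + if a + k = 2 * m then 1 else 0
    refine ⟨fun k i => f k (i + 1), ?_, ?_, ?_, ?_, fun k hk i => ?_⟩
    · ext i
      have := i.2
      simp only [f, Pi.zero_apply]
      split_ifs <;> first | omega | tauto
    · ext i
      have := i.2
      simp only [f, affineAdj_A]
      split_ifs <;> omega
    · ext i
      have := i.2
      simp only [f, Pi.zero_apply]
      split_ifs <;> omega
    · ext i
      have := i.2
      simp only [f, affineAdj_A]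
      split_ifs <;> omega
    · rw [sum_adj_A m hm (f (k + 1))]
      · have := i.2
        simp only [f]
        split_ifs <;> omega
      · simp only [f]
        split_ifs <;> first | omega | tauto
      · simp only [f]
        split_ifs <;> omega
  | D n hn =>
    have hr : (D n hn).rank = n := rfl
    have hh : (D n hn).coxeterNumber = 2 * n - 2 := rfl
    -- On the chain up to the branch vertex `n - 2`, pulses run at `k ± 1` and at their mirror
    -- images under `k ↦ 2n - 2 - k`. The two end vertices `n - 1` and `n` are hit at times `n - 2`
    -- and `n`.
    let f : ℕ → ℕ → ℤ := fun k a =>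
      if a = 0 ∨ k = 0 ∨ k + 2 = 2 * n then 0
      else if a + 2 ≤ n then (if a + 1 = k ∨ a = k + 1 then 1 else 0) +
        if a + k + 3 = 2 * n ∨ a + k + 1 = 2 * n then 1 else 0
      else if k + 2 = n ∨ k = n then 1 else 0
    refine ⟨fun k i => f k (i + 1), ?_, ?_, ?_, ?_, fun k hk i => ?_⟩
    · ext i
      simp [f]
    · ext i
      have := i.2
      simp only [f, affineAdj_D]
      split_ifs <;> first | omega | tauto
    · ext i
      have := i.2
      simp only [f, Pi.zero_apply]
      split_ifs <;> omega
    · ext i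
      have := i.2
      simp only [f, affineAdj_D]
      split_ifs <;> first | omega | tauto
    · rw [sum_adj_D n hn (f (k + 1)) (by simp [f])]
      have := i.2
      simp only [f]
      rcases Nat.lt_or_ge (i + 3) n with h3 | h3
      · grind (splits := 20)
      rcases h3.eq_or_lt with h3 | h3
      · grind (splits := 20)
      · grind (splits := 20)
  | E6 =>
    -- Only the first half of the symmetric sequence is listed, and trailing zeros are left to the
    -- default value; likewise for `E7` and `E8`.
    let c : ℕ → Fin E6.rank → ℤ := fun k i => ([[], [0, 1],
      [0, 0, 0, 1], [0, 0, 1, 0, 1], [1, 0, 0, 1, 0, 1],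
      [0, 1, 1, 0, 1], [0, 0, 0, 2]].getD (min k (12 - k)) []).getD i 0
    have h : ∀ k < 11, ∀ i, ∑ j, E6.adj i j * c (k + 1) j = c k i + c (k + 2) i := by decide
    exact ⟨c, by decide, by decide, by decide, by decide,
      fun k hk => h k (by change k + 2 ≤ 12 at hk; omega)⟩
  | E7 =>
    let c : ℕ → Fin E7.rank → ℤ := fun k i => ([[], [1], [0, 0, 1], [0, 0, 0, 1], [0, 1, 0, 0, 1],
      [0, 0, 0, 1, 0, 1], [0, 0, 1, 0, 1, 0, 1], [1, 0, 0, 1, 0, 1], [0, 1, 1, 0, 1],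
      [0, 0, 0, 2]].getD (min k (18 - k)) []).getD i 0
    have h : ∀ k < 17, ∀ i, ∑ j, E7.adj i j * c (k + 1) j = c k i + c (k + 2) i := by decide
    exact ⟨c, by decide, by decide, by decide, by decide,
      fun k hk => h k (by change k + 2 ≤ 18 at hk; omega)⟩
  | E8 =>
    let c : ℕ → Fin E8.rank → ℤ := fun k i => ([[], [0, 0, 0, 0, 0, 0, 0, 1],
      [0, 0, 0, 0, 0, 0, 1], [0, 0, 0, 0, 0, 1], [0, 0, 0, 0, 1], [0, 0, 0, 1], [0, 1, 1],
      [1, 0, 0, 1], [0, 0, 1, 0, 1], [0, 0, 0, 1, 0, 1], [0, 1, 0, 0, 1, 0, 1],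
      [0, 0, 0, 1, 0, 1, 0, 1], [0, 0, 1, 0, 1, 0, 1], [1, 0, 0, 1, 0, 1], [0, 1, 1, 0, 1],
      [0, 0, 0, 2]].getD (min k (30 - k)) []).getD i 0
    have h : ∀ k < 29, ∀ i, ∑ j, E8.adj i j * c (k + 1) j = c k i + c (k + 2) i := by decide
    exact ⟨c, by decide, by decide, by decide, by decide,
      fun k hk => h k (by change k + 2 ≤ 30 at hk; omega)⟩

end Diagram
end McKay

namespace McKay
namespace Diagram

/-! ### The assembling polynomials -/

variable {Δ : Diagram} {Y : Finset (Fin Δ.rank)} {β : Fin Δ.rank → ℤ}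

theorem IsHighestRoot.cartan_eq (hβ : Δ.IsHighestRoot β) (i : Fin Δ.rank) :
    Δ.cartan β i = Δ.affineAdj i := by
  obtain ⟨θ, hpos, hθ, hsum⟩ := Δ.exists_marks
  have hθθ : Δ.form θ θ = 2 := by simp only [form, hθ, hsum]
  have hβθ : 2 ≤ Δ.form θ β := by
    rw [form_comm]
    simp only [form, hθ]
    exact Δ.two_le_sum_mul_affineAdj (hβ.one_le Δ) (hβ.cartan_nonneg Δ)
  -- The norm of `β - θ` is 2 minus twice a number at least 2, plus 2, hence nonpositive.
  have h := Δ.cartan_eq_zero_of_form_nonpos hpos hθ (x := β - θ)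
    (by rw [form_sub_sub, hβ.1.form_self, hθθ]; linarith) i
  rw [cartan_sub, hθ] at h
  linarith

theorem tauDiff_eq_of_recurrence (hβ : Δ.IsHighestRoot β) (hY : Δ.IsBipartition Y)
    (hfix : Δ.reflect Yᶜ β = β) {c : ℕ → Fin Δ.rank → ℤ} (h0 : c 0 = 0) (h1 : c 1 = Δ.affineAdj)
    {h : ℕ} (hrec : ∀ k, k + 2 ≤ h → ∀ i, ∑ j, Δ.adj i j * c (k + 1) j = c k i + c (k + 2) i)
    (k : ℕ) (hk : k + 1 ≤ h) : Δ.tauDiff Y β k = c (k + 1) := by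
  have hd0 : Δ.tauDiff Y β 0 = c 1 := by
    ext i
    rw [tauDiff_zero hfix, hβ.cartan_eq, h1]
  induction k using Nat.strong_induction_on with
  | _ k ih =>
    match k with
    | 0 => exact hd0
    | 1 =>
      ext i
      rw [hY.tauDiff_one hfix, hd0, hrec 0 hk, h0, Pi.zero_apply, zero_add]
    | k + 2 =>
      ext i
      have := hY.tauDiff_add_two (β := β) k i
      rw [ih k (by omega) (by omega), ih (k + 1) (by omega) (by omega),
        hrec (k + 1) (by omega)] at this
      exact add_left_cancel this

theorem two_le_coxeterNumber (Δ : Diagram) : 2 ≤ Δ.coxeterNumber := by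
  cases Δ <;> simp only [coxeterNumber] <;> omega

/-- Vanishing of `f` at both ends leaves no terms in degrees `-1` and `h + 2`; in the degrees 0 and
`h + 1` only one of the two shifts contributes. -/
theorem laurent_sum_recurrence {f g : ℕ → ℤ} {h : ℕ} (hf0 : f 0 = 0) (hfh : f (h + 1) = 0)
    (hg0 : g 0 = f 1) (hgh : g (h + 1) = f h)
    (hg : ∀ k, k + 1 < h + 1 → g (k + 1) = f k + f (k + 2)) :
    ((LaurentPolynomial.T 1 + LaurentPolynomial.T (-1)) * ∑ n ∈ Finset.range (h + 2),
      LaurentPolynomial.C (f n) * LaurentPolynomial.T (n : ℤ) : ℤ[T;T⁻¹]) =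
    ∑ n ∈ Finset.range (h + 2), LaurentPolynomial.C (g n) * LaurentPolynomial.T (n : ℤ) := by
  have hT : ∀ (a : ℤ) (b : ℤ) (x : ℤ[T;T⁻¹]), LaurentPolynomial.T a * (x * LaurentPolynomial.T b) =
      x * LaurentPolynomial.T (a + b) := fun a b x => by
    rw [LaurentPolynomial.T_add]; ring
  have hup : LaurentPolynomial.T 1 * ∑ n ∈ Finset.range (h + 2),
      LaurentPolynomial.C (f n) * LaurentPolynomial.T (n : ℤ) =
      ∑ n ∈ Finset.range (h + 1), (LaurentPolynomial.C (f n) *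
        LaurentPolynomial.T ((n + 1 : ℕ) : ℤ) : ℤ[T;T⁻¹]) := by
    rw [Finset.sum_range_succ, hfh, map_zero, zero_mul, add_zero, Finset.mul_sum]
    refine Finset.sum_congr rfl fun n _ => ?_
    rw [hT]
    push_cast
    rw [add_comm]
  have hdown : LaurentPolynomial.T (-1) * ∑ n ∈ Finset.range (h + 2),
      LaurentPolynomial.C (f n) * LaurentPolynomial.T (n : ℤ) =
      ∑ n ∈ Finset.range (h + 1), (LaurentPolynomial.C (f (n + 1)) *
        LaurentPolynomial.T (n : ℤ) : ℤ[T;T⁻¹]) := by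
    rw [Finset.sum_range_succ', hf0, map_zero, zero_mul, add_zero, Finset.mul_sum]
    refine Finset.sum_congr rfl fun n _ => ?_
    rw [hT]
    push_cast
    rw [neg_add_eq_sub, add_sub_cancel_right]
  rw [add_mul, hup.trans (Finset.sum_range_succ _ _), hdown.trans (Finset.sum_range_succ' _ _),
    Finset.sum_range_succ', Finset.sum_range_succ _ h, hg0, hgh]
  have : ∑ n ∈ Finset.range h, (LaurentPolynomial.C (g (n + 1)) *
      LaurentPolynomial.T ((n + 1 : ℕ) : ℤ) : ℤ[T;T⁻¹]) =
      ∑ n ∈ Finset.range h, LaurentPolynomial.C (f n) * LaurentPolynomial.T ((n + 1 : ℕ) : ℤ) +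
      ∑ n ∈ Finset.range h, LaurentPolynomial.C (f (n + 2)) *
        LaurentPolynomial.T ((n + 1 : ℕ) : ℤ) := by
    rw [← Finset.sum_add_distrib]
    refine Finset.sum_congr rfl fun n hn => ?_
    rw [hg n (by have := Finset.mem_range.1 hn; omega), map_add, add_mul]
  rw [this]
  ring

theorem IsHighestRoot.assemblingPolynomial_recurrence (hβ : Δ.IsHighestRoot β)
    (hY : Δ.IsBipartition Y) (hfix : Δ.reflect Yᶜ β = β) {i : Fin (Δ.rank + 1)} (hi : i ≠ 0) :
    (LaurentPolynomial.T 1 + LaurentPolynomial.T (-1)) * Δ.assemblingPolynomial Y β i =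
      ((Δ.semiAffineAdj.map (Nat.cast : ℕ → ℤ[T;T⁻¹])).mulVec
        (Δ.assemblingPolynomial Y β)) i := by
  obtain ⟨i, rfl⟩ := Fin.exists_succ_eq.2 hi
  obtain ⟨c, h0, h1, hh, hh1, hrec⟩ := Δ.exists_recurrence_solution
  have hc := tauDiff_eq_of_recurrence hβ hY hfix h0 h1 hrec
  obtain ⟨h, hcox⟩ : ∃ h, Δ.coxeterNumber = h + 2 := ⟨Δ.coxeterNumber - 2, by
    have := Δ.two_le_coxeterNumber; omega⟩
  have hz : ∀ n ≤ h + 2, ∀ j : Fin Δ.rank, Δ.assemblingVector Y β n j.succ = c n j := by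
    intro n hn j
    rw [assemblingVector]
    split_ifs with hn'
    · rcases hn' with rfl | rfl
      · simp [h0]
      · simp [hh]
    · obtain ⟨k, rfl⟩ : ∃ k, n = k + 1 := ⟨n - 1, by omega⟩
      rw [Fin.cons_succ, ← hc k (by omega)]
      rfl
  have hz0 : ∀ n, Δ.assemblingVector Y β n 0 = if n = 0 ∨ n = h + 2 then 1 else 0 := by
    intro n
    rw [assemblingVector, hcox]
    split_ifs <;> simp
  have hRHS : ((Δ.semiAffineAdj.map (Nat.cast : ℕ → ℤ[T;T⁻¹])).mulVec
      (Δ.assemblingPolynomial Y β)) i.succ = ∑ n ∈ Finset.range (h + 3),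
      LaurentPolynomial.C (∑ j, (Δ.extAdj i.succ j : ℤ) * Δ.assemblingVector Y β n j) *
        LaurentPolynomial.T (n : ℤ) := by
    simp only [Matrix.mulVec, dotProduct, Matrix.map_apply, semiAffineAdj, Fin.succ_ne_zero,
      if_false, assemblingPolynomial, Finset.mul_sum, hcox]
    rw [Finset.sum_comm]
    refine Finset.sum_congr rfl fun n _ => ?_
    rw [map_sum, Finset.sum_mul]
    refine Finset.sum_congr rfl fun j _ => ?_
    rw [map_mul, mul_assoc]
    congr 1
  -- The affine vertex contributes only at `n = 0` and at the Coxeter number. There it gives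
  -- `affineAdj`, equal to `c` at 1 and at the Coxeter number minus one.
  have hsum : ∀ n ≤ h + 2, ∑ j, (Δ.extAdj i.succ j : ℤ) * Δ.assemblingVector Y β n j =
      Δ.affineAdj i * (if n = 0 ∨ n = h + 2 then 1 else 0) + ∑ j, Δ.adj i j * c n j := by
    intro n hn
    rw [Fin.sum_univ_succ, hz0]
    congr 1
    exact Finset.sum_congr rfl fun j _ => by rw [hz n hn]; rfl
  rw [hcox] at hh hh1 hrec
  rw [hRHS, assemblingPolynomial, hcox]
  refine laurent_sum_recurrence (h := h + 1) ?_ ?_ ?_ ?_ fun k hk => ?_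
  · rw [hz 0 (by omega), h0, Pi.zero_apply]
  · rw [hz _ (by omega), hh, Pi.zero_apply]
  · rw [hz _ (by omega), hsum 0 (by omega), h0, h1]
    simp
  · rw [hz _ (by omega), hsum _ le_rfl, hh, show h + 1 = h + 2 - 1 by omega, hh1]
    simp
  · rw [hz _ (by omega), hz _ (by omega), hsum _ (by omega), hrec k (by omega),
      if_neg (by omega), mul_zero, zero_add]

end Diagram
end McKay

/-- McKay's observation for the Kostant generating functions of the finite subgroups of `SU(2)`
of type `A_{2m-1}`, `D_n`, `E_n`, and its form for the assembling polynomials.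
Here `HahnSeries.single k 1` is the Laurent series `t^k`. -/
theorem mainTheorem2 (Δ : McKay.Diagram) :
    (∀ (G : Subgroup McKay.SU2) [Finite G] (V : Fin (Δ.rank + 1) → Type u)
        [∀ i, AddCommGroup (V i)] [∀ i, Module ℂ (V i)] (ρ : ∀ i, Representation ℂ G (V i)),
        McKay.IsIrrepList ρ → McKay.mckayMatrix G ρ = Δ.extAdj →
        ∀ i : Fin (Δ.rank + 1), i ≠ 0 →
          (HahnSeries.single 1 1 + HahnSeries.single (-1) 1) * McKay.kostantSeries G ρ i =
            ∑ j, Δ.extAdj i j • McKay.kostantSeries G ρ j) ∧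
    (∀ (β : Fin Δ.rank → ℤ) (Y : Finset (Fin Δ.rank)),
        Δ.IsHighestRoot β → Δ.IsBipartition Y → Δ.reflect Yᶜ β = β →
        ∀ i : Fin (Δ.rank + 1), i ≠ 0 →
          (LaurentPolynomial.T 1 + LaurentPolynomial.T (-1)) * Δ.assemblingPolynomial Y β i =
            ((Δ.semiAffineAdj.map (Nat.cast : ℕ → ℤ[T;T⁻¹])).mulVec
              (Δ.assemblingPolynomial Y β)) i) := by
  refine ⟨fun G _ V _ _ ρ hρ hG i hi => ?_, fun β Y hβ hY hfix i hi =>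
    hβ.assemblingPolynomial_recurrence hY hfix hi⟩
  rw [hρ.kostantSeries_recurrence hi]
  -- The recurrence uses the column of the McKay matrix, the claim the row; symmetry of the extended
  -- diagram identifies them.
  exact Finset.sum_congr rfl fun j _ => by rw [hG, Δ.extAdj_comm]
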